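/- For a closed convex set $K\subseteq\mathbb{R}^2$ with non-empty interior, a closed generalized billiard trajectory of $K$ is a non-constant closed polygonal curve contained in $K$ such that, at every point of the curve where its direction changes, the curve is on $\partial K$ and the outgoing direction is the reflection of the incoming direction in one of the supporting lines to $K$ at that point. Let $\alpha(K)\in[0,\infty]$ be the infimum of the lengths of the closed generalized billiard trajectories of $K$ ($\alpha(K)=\infty$ if there are none). For a planar convex body $K$ (compact, convex, with non-empty interior) and $z\in\mathbb{R}^2$ put $$K^z=\{y\in\mathbb{R}^2 : \langle x-z,y\rangle\le 1 \text{ for all } x\in K\},\qquad \beta(K)=\inf_{z\in\mathbb{R}^2}\alpha(K)\,\alpha(K^z).$$ For a line $\ell$, the Steiner symmetrization $S_\ell(K)$ is obtained from $K$ by translating each non-empty section of $K$ by a line $m$ orthogonal to $\ell$ (a point or a segment) along $m$ so that its midpoint lies on $\ell$. Let $T\subseteq\mathbb{R}^2$ be a non-degenerate triangle and let $\ell$ be the line containing one of its altitudes (that is, the line through a vertex orthogonal to the line through the other two vertices; the altitude may be inside or outside $T$). Then $$\beta(T)\le\beta(S_\ell(T)).$$ -/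

import Mathlib

namespace Billiard

noncomputable section

variable {E : Type*} [NormedAddCommGroup E] [InnerProductSpace ℝ E]

/-- The unit direction of the edge of the closed polygon `q` from `q i` to `q (i + 1)`.
Indices are cyclic: in `Fin (m + 1)` the last index plus one is `0`. -/
def edgeDir {m : ℕ} (q : Fin (m + 1) → E) (i : Fin (m + 1)) : E :=
  ‖q (i + 1) - q i‖⁻¹ • (q (i + 1) - q i)

/-- `n` is the outer unit normal of a supporting hyperplane to `K` at the point `x` of `K`. -/
def IsUnitNormalAt (K : Set E) (x n : E) : Prop :=
  x ∈ K ∧ ‖n‖ = 1 ∧ ∀ y ∈ K, inner ℝ (y - x) n ≤ 0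

/-- The closed polygonal curve with consecutive vertices `q 0, …, q m` (then back to `q 0`) is a
closed generalized billiard trajectory of the closed convex set `K`: it is a nondegenerate curve
contained in `K`, and wherever its direction changes it is at a boundary point of `K` and it is
reflected in one of the supporting hyperplanes to `K` at that point. -/
structure IsClosedBilliardTrajectory (K : Set E) {m : ℕ} (q : Fin (m + 1) → E) : Prop where
  ne_succ : ∀ i, q i ≠ q (i + 1)
  edge_subset : ∀ i, segment ℝ (q i) (q (i + 1)) ⊆ K
  bounce : ∀ i, edgeDir q i ≠ edgeDir q (i + 1) →
    q (i + 1) ∈ frontier K ∧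
      ∃ n, IsUnitNormalAt K (q (i + 1)) n ∧
        edgeDir q (i + 1) = edgeDir q i - (2 * inner ℝ (edgeDir q i) n) • n

/-- The length of the closed polygon `q`. -/
def perimeter {m : ℕ} (q : Fin (m + 1) → E) : ℝ :=
  ∑ i, ‖q (i + 1) - q i‖

/-- `α(K)`: the (infimal) length of the closed generalized billiard trajectories of `K`. It is `∞`
if there are none. -/
def alpha (K : Set E) : ENNReal :=
  ⨅ (m : ℕ) (q : Fin (m + 1) → E) (_ : IsClosedBilliardTrajectory K q),
    ENNReal.ofReal (perimeter q)

/-- The polar body `K^z` of `K` with respect to `z`. -/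
def polarBody (K : Set E) (z : E) : Set E :=
  {y | ∀ x ∈ K, inner ℝ (x - z) y ≤ 1}

/-- The billiard product `β(K) = inf_z α(K) α(K^z)`. -/
def beta (K : Set E) : ENNReal :=
  ⨅ z : E, alpha K * alpha (polarBody K z)

/-- The Steiner symmetrization of a convex body `K` with respect to a hyperplane `H`: each
nonempty section of `K` by the line through a point `p` of `H` orthogonal to `H` is a segment with
endpoints `a`, `b` (possibly `a = b`), and is translated so that its midpoint becomes `p`. -/
def steinerSymm (H : AffineSubspace ℝ E) (K : Set E) : Set E :=
  {x | ∃ p ∈ H, ∃ a b : E,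
    K ∩ (AffineSubspace.mk' p H.directionᗮ : Set E) = segment ℝ a b ∧
      x + (midpoint ℝ a b - p) ∈ segment ℝ a b}

end

end Billiard

/-!
The quantity `β` of a triangle `T` can be computed. Let `X` be twice its area, `r` the radius of the
smallest disc containing it, and `L` the length of its longest side. Then `α(T) = X / r`, the
infimum over `z` of `α(T^z)` is `8 / L`, and so `β(T) = 8 X / (r L)`. Symmetrizing with respect to
an altitude keeps base and height, hence `X`, and increases neither `r`
(`exists_norm_isoscelize_sub_le`) nor `L` (`norm_isoscelize_sub_le`).

Lower bounds come from duality. Around a closed billiard trajectory the changes of direction sum up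
to zero, so its normals at bounce points are positively dependent and it cannot be pushed into the
interior of the body (`IsClosedBilliardTrajectory.exists_normal`). In an intersection of three
half-planes it therefore touches the relevant sides, and a closed triangle whose edges are multiples
of the outer normals and which fits into a small disc bounds the length from below
(`IsClosedBilliardTrajectory.sum_le_mul_perimeter`). For `α(T)` this dual triangle is a rotated and
rescaled copy of `T` (`ofReal_le_alpha_triangle`). For `T^z` it has the edges `λ k • (v k - z)`,
with `λ` the barycentric coordinates of `z`, and has to be put into a disc of radius `L / 8`
(`ofReal_le_alpha_polarBody`). If it is not acute, one of its edges is a diameter of an enclosing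
disc, and `4 λ (1 - λ) ≤ 1` suffices. If it is acute, all sides of `T` are seen from `z` under
obtuse angles, the circumradius of the dual triangle is the product of the distances from `z` to the
vertices divided by `2 X`, and the maximum principle for the polynomial with roots at the vertices
reduces the estimate to the case of a right angle (`four_mul_norm_mul_norm_mul_norm_le`).

Upper bounds are given by explicit trajectories: the orthic triangle or an altitude of `T`
(`exists_alpha_triangle_le`), and a double normal of the polar body with respect to the midpoint of
the longest side (`alpha_polarBody_midpoint_le`). That midpoint is a boundary point of `T`, so the
polar body is unbounded there, which the definition of `β` allows.

Indices of vertices are in `Fin 3` and cyclic; the side opposite to `v k` joins `v (k + 1)` and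
`v (k + 2)`.
-/

namespace Billiard

/-! ### Closed polygons and their directions -/

theorem sum_cyclic_sub {F : Type*} [AddCommGroup F] {m : ℕ} (f : Fin (m + 1) → F) :
    ∑ i, (f (i + 1) - f i) = 0 := by
  rw [Finset.sum_sub_distrib, sub_eq_zero]
  exact Equiv.sum_comp (Equiv.addRight (1 : Fin (m + 1))) f

/-- A closed polygon is at least as long as the triangle formed by three of its vertices. -/
theorem norm_sub_add_norm_sub_add_norm_sub_le_perimeter {F : Type*} [NormedAddCommGroup F]
    {m : ℕ} (q : Fin (m + 1) → F) (i j k : Fin (m + 1)) :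
    ‖q i - q j‖ + ‖q j - q k‖ + ‖q k - q i‖ ≤ perimeter q := by
  have main : ∀ i j k : Fin (m + 1), i ≤ j → j ≤ k →
      ‖q i - q j‖ + ‖q j - q k‖ + ‖q k - q i‖ ≤ perimeter q := by
    intro i j k hij hjk
    set Q : ℕ → F := fun n => q (Fin.ofNat (m + 1) n) with hQ
    have hQi : ∀ i : Fin (m + 1), Q i = q i := fun i => by simp [hQ]
    have hper : perimeter q = ∑ n ∈ Finset.Ico 0 (m + 1), dist (Q n) (Q (n + 1)) := by
      rw [perimeter, ← Finset.range_eq_Ico, Finset.sum_range]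
      refine Finset.sum_congr rfl fun i _ => ?_
      rw [dist_comm, dist_eq_norm, hQi]
      congr 2
      simp only [hQ]
      congr 1
      ext
      simp [Fin.val_add]
    have hlast : Q (m + 1) = Q 0 := by simp [hQ]
    have hi := i.2
    have hj := j.2
    have hk := k.2
    have h1 := dist_le_Ico_sum_dist Q (Fin.le_def.1 hij)
    have h2 := dist_le_Ico_sum_dist Q (Fin.le_def.1 hjk)
    have h3 := dist_le_Ico_sum_dist Q hk.le
    have h4 := dist_le_Ico_sum_dist Q (Nat.zero_le i.1)
    -- the way from `q k` to `q i` passes through the last edge, back to `q 0`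
    have h5 := dist_triangle (Q k) (Q (m + 1)) (Q i)
    rw [hlast] at h5 h3
    rw [hper, ← Finset.sum_Ico_consecutive _ (Nat.zero_le i.1) hi.le,
      ← Finset.sum_Ico_consecutive _ (Fin.le_def.1 hij) hj.le,
      ← Finset.sum_Ico_consecutive _ (Fin.le_def.1 hjk) hk.le]
    simp only [hQi] at h1 h2 h3 h4 h5
    simp only [dist_eq_norm] at h1 h2 h3 h4 h5 ⊢
    linarith
  have r1 := norm_sub_rev (q i) (q j)
  have r2 := norm_sub_rev (q j) (q k)
  have r3 := norm_sub_rev (q k) (q i)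
  rcases le_total i j with h1 | h1 <;> rcases le_total j k with h2 | h2 <;>
    rcases le_total i k with h3 | h3
  · linarith [main i j k h1 h2]
  · linarith [main i j k h1 h2]
  · linarith [main i k j h3 h2]
  · linarith [main k i j h3 h1]
  · linarith [main j i k h1 h3]
  · linarith [main j k i h2 h3]
  · linarith [main k j i h2 h1]
  · linarith [main k j i h2 h1]

variable {E : Type*} [NormedAddCommGroup E] [InnerProductSpace ℝ E]

theorem IsClosedBilliardTrajectory.mem {K : Set E} {m : ℕ} {q : Fin (m + 1) → E}
    (h : IsClosedBilliardTrajectory K q) (i : Fin (m + 1)) : q i ∈ K :=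
  h.edge_subset i (left_mem_segment ℝ _ _)

theorem norm_smul_edgeDir {m : ℕ} {q : Fin (m + 1) → E} {i : Fin (m + 1)}
    (h : q i ≠ q (i + 1)) : ‖q (i + 1) - q i‖ • edgeDir q i = q (i + 1) - q i := by
  rw [edgeDir, smul_smul, mul_inv_cancel₀ (norm_ne_zero_iff.2 (sub_ne_zero.2 h.symm)), one_smul]

theorem norm_edgeDir {m : ℕ} {q : Fin (m + 1) → E} {i : Fin (m + 1)}
    (h : q i ≠ q (i + 1)) : ‖edgeDir q i‖ = 1 := by
  rw [edgeDir, norm_smul, norm_inv, norm_norm,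
    inv_mul_cancel₀ (norm_ne_zero_iff.2 (sub_ne_zero.2 h.symm))]

/-- The direction of a closed polygon with distinct consecutive vertices changes somewhere. -/
theorem exists_edgeDir_ne {m : ℕ} {q : Fin (m + 1) → E} (h : ∀ i, q i ≠ q (i + 1)) :
    ∃ i, edgeDir q i ≠ edgeDir q (i + 1) := by
  by_contra! hc
  have hconst : ∀ i, edgeDir q i = edgeDir q 0 := by
    intro i
    induction i using Fin.induction with
    | zero => rfl
    | succ i ih => rw [← ih, hc i.castSucc, Fin.coeSucc_eq_succ]
  have h0 : ∑ i, inner ℝ (q (i + 1) - q i) (edgeDir q 0) = 0 := by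
    rw [← sum_inner, sum_cyclic_sub, inner_zero_left]
  have h1 : ∀ i, inner ℝ (q (i + 1) - q i) (edgeDir q 0) = ‖q (i + 1) - q i‖ := by
    intro i
    rw [← hconst i]
    nth_rw 1 [← norm_smul_edgeDir (h i)]
    rw [real_inner_smul_left, real_inner_self_eq_norm_sq, norm_edgeDir (h i), one_pow, mul_one]
  have h2 : 0 < ∑ i, inner ℝ (q (i + 1) - q i) (edgeDir q 0) := by
    refine Finset.sum_pos (fun i _ => ?_) Finset.univ_nonempty
    rw [h1]
    exact norm_pos_iff.2 (sub_ne_zero.2 (h i).symm)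
  exact h2.ne' h0

/-! ### Lower bounds for billiard trajectories in polyhedra -/

/-- A closed billiard trajectory of `K` cannot be pushed into the interior of `K`: the normals at
its bounce points are positively dependent, so they are not all on one side of `d`. -/
theorem IsClosedBilliardTrajectory.exists_normal {K : Set E} {m : ℕ} {q : Fin (m + 1) → E}
    (h : IsClosedBilliardTrajectory K q) (d : E) :
    ∃ i n, IsUnitNormalAt K (q i) n ∧ 0 ≤ inner ℝ d n := by
  by_contra! hc
  have key : ∀ i, edgeDir q i ≠ edgeDir q (i + 1) →
      0 < inner ℝ d (edgeDir q (i + 1) - edgeDir q i) := by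
    intro i hi
    obtain ⟨-, n, hn, e⟩ := h.bounce i hi
    have h1 := hc _ n hn
    have h2 : 0 ≤ inner ℝ (edgeDir q i) n := by
      rw [edgeDir, inner_smul_left]
      have := hn.2.2 _ (h.mem i)
      rw [← neg_sub, inner_neg_left] at this
      have h3 : 0 ≤ inner ℝ (q (i + 1) - q i) n := by linarith
      simp only [conj_trivial]
      positivity
    have h3 : inner ℝ (edgeDir q i) n ≠ 0 := by
      intro h0
      apply hi
      rw [e, h0]
      simp
    have h4 : 0 < inner ℝ (edgeDir q i) n := lt_of_le_of_ne h2 h3.symm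
    rw [e, sub_sub_cancel_left, inner_neg_right, inner_smul_right]
    nlinarith
  obtain ⟨i, hi⟩ := exists_edgeDir_ne h.ne_succ
  have hs : ∑ i, inner ℝ d (edgeDir q (i + 1) - edgeDir q i) = 0 := by
    rw [← inner_sum, sum_cyclic_sub, inner_zero_right]
  have hp : 0 < ∑ i, inner ℝ d (edgeDir q (i + 1) - edgeDir q i) := by
    refine Finset.sum_pos' (fun j _ => ?_) ⟨i, Finset.mem_univ _, key i hi⟩
    by_cases hj : edgeDir q j = edgeDir q (j + 1)
    · rw [hj, sub_self, inner_zero_right]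
    · exact (key j hj).le
  exact hp.ne' hs

/-- A closed billiard trajectory of a polyhedron meets, for every direction `d`, a face whose outer
normal has nonnegative inner product with `d`. -/
theorem IsClosedBilliardTrajectory.exists_touch {κ : Type*} [Finite κ] {w : κ → E} {c : κ → ℝ}
    {m : ℕ} {q : Fin (m + 1) → E}
    (h : IsClosedBilliardTrajectory {y | ∀ k, inner ℝ (w k) y ≤ c k} q) (d : E) :
    ∃ i k, inner ℝ (w k) (q i) = c k ∧ 0 ≤ inner ℝ (w k) d := by
  obtain ⟨i, n, hn, hd⟩ := h.exists_normal d
  by_contra! hc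
  have hi := h.mem i
  -- moving `q i` slightly in the direction `d`, and then a little more along `n`, stays inside
  have hev : ∀ k, ∀ᶠ t in nhdsWithin (0 : ℝ) (Set.Ioi 0),
      inner ℝ (w k) (q i + t • d) < c k := by
    intro k
    rcases (hi k).lt_or_eq with hlt | heq
    · have : Filter.Tendsto (fun t : ℝ => inner ℝ (w k) (q i + t • d)) (nhds 0)
          (nhds (inner ℝ (w k) (q i + (0 : ℝ) • d))) := by
        apply Continuous.tendsto
        fun_prop
      rw [zero_smul, add_zero] at this
      exact (this.mono_left nhdsWithin_le_nhds).eventually_lt_const hlt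
    · filter_upwards [self_mem_nhdsWithin] with t ht
      have := hc i k heq
      rw [inner_add_right, inner_smul_right, heq]
      nlinarith [Set.mem_Ioi.1 ht]
  obtain ⟨t, ht, ht0⟩ :=
    ((Filter.eventually_all.2 hev).and self_mem_nhdsWithin).exists
  have hev2 : ∀ k, ∀ᶠ s in nhdsWithin (0 : ℝ) (Set.Ioi 0),
      inner ℝ (w k) (q i + t • d + s • n) < c k := by
    intro k
    have : Filter.Tendsto (fun s : ℝ => inner ℝ (w k) (q i + t • d + s • n)) (nhds 0)
        (nhds (inner ℝ (w k) (q i + t • d + (0 : ℝ) • n))) := by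
      apply Continuous.tendsto
      fun_prop
    rw [zero_smul, add_zero] at this
    exact (this.mono_left nhdsWithin_le_nhds).eventually_lt_const (ht k)
  obtain ⟨s, hs, hs0⟩ :=
    ((Filter.eventually_all.2 hev2).and self_mem_nhdsWithin).exists
  have := hn.2.2 _ (fun k => (hs k).le)
  rw [add_assoc, add_sub_cancel_left, inner_add_left, inner_smul_left, inner_smul_left,
    real_inner_self_eq_norm_sq, hn.2.1] at this
  simp only [conj_trivial] at this
  have h1 : 0 ≤ t * inner ℝ d n := mul_nonneg (le_of_lt ht0) hd
  have h2 : (0 : ℝ) < s := hs0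
  linarith

/-- Lower bound for the length of a closed billiard trajectory `q` of the intersection of three
half-spaces `⟪w k, ·⟫ ≤ c k`. A closed triangle with edges `lam k • w k` and vertices in a ball of
radius `ρ` around the origin is a dual certificate: a face with `lam k > 0` is met by `q`, and the
length of the triangle formed by the three contact points, times `ρ`, is at least
`∑ k, lam k * c k`. -/
theorem IsClosedBilliardTrajectory.sum_le_mul_perimeter {w : Fin 3 → E} {c : Fin 3 → ℝ}
    {m : ℕ} {q : Fin (m + 1) → E}
    (h : IsClosedBilliardTrajectory {y | ∀ k, inner ℝ (w k) y ≤ c k} q)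
    {lam : Fin 3 → ℝ} (hlam : ∀ k, 0 ≤ lam k)
    (hd : ∀ k, 0 < lam k → ∃ d, ∀ j, j ≠ k → inner ℝ (w j) d < 0)
    {y : Fin 3 → E} (hy : ∀ k, y (k + 2) - y (k + 1) = lam k • w k)
    {ρ : ℝ} (hρ : ∀ k, ‖y k‖ ≤ ρ) :
    ∑ k, lam k * c k ≤ ρ * perimeter q := by
  have hp : ∀ k, ∃ i, lam k * inner ℝ (w k) (q i) = lam k * c k := by
    intro k
    rcases (hlam k).eq_or_lt with h0 | h0
    · exact ⟨0, by rw [← h0, zero_mul, zero_mul]⟩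
    · obtain ⟨d, hd⟩ := hd k h0
      obtain ⟨i, j, hj, hjd⟩ := h.exists_touch d
      have : j = k := by
        by_contra hne
        exact absurd hjd (not_le.2 (hd j hne))
      subst this
      exact ⟨i, by rw [hj]⟩
  choose i hi using hp
  have e0 := hy 0
  have e1 := hy 1
  have e2 := hy 2
  simp only [Fin.isValue, zero_add, show (1 : Fin 3) + 2 = 0 from rfl,
    show (1 : Fin 3) + 1 = 2 from rfl, show (2 : Fin 3) + 2 = 1 from rfl,
    show (2 : Fin 3) + 1 = 0 from rfl] at e0 e1 e2
  have key : ∑ k, lam k * c k = inner ℝ (y 2) (q (i 0) - q (i 1)) +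
      inner ℝ (y 0) (q (i 1) - q (i 2)) + inner ℝ (y 1) (q (i 2) - q (i 0)) := by
    rw [Fin.sum_univ_three, ← hi, ← hi, ← hi, ← real_inner_smul_left, ← real_inner_smul_left,
      ← real_inner_smul_left, ← e0, ← e1, ← e2]
    simp only [inner_sub_left, inner_sub_right]
    ring
  have hb : ∀ k (x : E), inner ℝ (y k) x ≤ ρ * ‖x‖ := fun k x =>
    (real_inner_le_norm _ _).trans (mul_le_mul_of_nonneg_right (hρ k) (norm_nonneg _))
  have hρ0 : 0 ≤ ρ := (norm_nonneg _).trans (hρ 0)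
  have := mul_le_mul_of_nonneg_left
    (norm_sub_add_norm_sub_add_norm_sub_le_perimeter q (i 0) (i 1) (i 2)) hρ0
  rw [key]
  linarith [hb 2 (q (i 0) - q (i 1)), hb 0 (q (i 1) - q (i 2)), hb 1 (q (i 2) - q (i 0))]

/-! ### Constructing billiard trajectories -/

theorem IsUnitNormalAt.mem_frontier {K : Set E} {x n : E} (h : IsUnitNormalAt K x n) :
    x ∈ frontier K := by
  refine ⟨subset_closure h.1, fun hx => ?_⟩
  have hev : ∀ᶠ t in nhdsWithin (0 : ℝ) (Set.Ioi 0), x + t • n ∈ K := by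
    have : Filter.Tendsto (fun t : ℝ => x + t • n) (nhds 0) (nhds (x + (0 : ℝ) • n)) := by
      apply Continuous.tendsto
      fun_prop
    rw [zero_smul, add_zero] at this
    exact (this.mono_left nhdsWithin_le_nhds).eventually (mem_interior_iff_mem_nhds.1 hx)
  obtain ⟨t, ht, ht0⟩ := (hev.and self_mem_nhdsWithin).exists
  have := h.2.2 _ ht
  rw [add_sub_cancel_left, real_inner_smul_left, real_inner_self_eq_norm_sq, h.2.1] at this
  have h2 : (0 : ℝ) < t := ht0
  linarith

/-- A vector `n ≠ 0` with `u' - u` a negative multiple of `n` reflects the unit vector `u` to the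
unit vector `u'`; after normalization it serves as the normal of the reflection. -/
theorem exists_isUnitNormalAt_reflect {K : Set E} {x u u' : E} (hx : x ∈ K) (hu : ‖u‖ = 1)
    (hu' : ‖u'‖ = 1) (hne : u ≠ u') (hK : ∀ y ∈ K, 0 ≤ inner ℝ (y - x) (u' - u)) :
    ∃ n, IsUnitNormalAt K x n ∧ u' = u - (2 * inner ℝ u n) • n := by
  have h0 : ‖u' - u‖ ≠ 0 := norm_ne_zero_iff.2 (sub_ne_zero.2 hne.symm)
  refine ⟨-‖u' - u‖⁻¹ • (u' - u), ⟨hx, ?_, fun y hy => ?_⟩, ?_⟩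
  · rw [norm_smul, norm_neg, norm_inv, norm_norm, inv_mul_cancel₀ h0]
  · rw [inner_smul_right]
    have := hK y hy
    have : 0 ≤ ‖u' - u‖⁻¹ * inner ℝ (y - x) (u' - u) := by positivity
    linarith
  · have h1 : ‖u' - u‖ ^ 2 = -2 * inner ℝ u (u' - u) := by
      rw [norm_sub_sq_real, inner_sub_right, real_inner_self_eq_norm_sq, hu, hu',
        real_inner_comm u]
      ring
    have h2 : 2 * inner ℝ u (-‖u' - u‖⁻¹ • (u' - u)) * -‖u' - u‖⁻¹ = -1 := by
      rw [inner_smul_right]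
      field_simp
      linarith
    rw [smul_smul, h2]
    simp

/-- A double normal of `K` is run back and forth by a closed billiard trajectory. -/
theorem alpha_le_of_double_normal {K : Set E} (hK : Convex ℝ K) {x y : E} (hx : x ∈ K)
    (hy : y ∈ K) (hxy : x ≠ y) (h1 : ∀ p ∈ K, 0 ≤ inner ℝ (p - x) (y - x))
    (h2 : ∀ p ∈ K, 0 ≤ inner ℝ (p - y) (x - y)) :
    alpha K ≤ ENNReal.ofReal (2 * ‖y - x‖) := by
  set q : Fin (1 + 1) → E := ![x, y] with hq
  have hn : ‖y - x‖ ≠ 0 := norm_ne_zero_iff.2 (sub_ne_zero.2 hxy.symm)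
  have hd0 : edgeDir q 0 = ‖y - x‖⁻¹ • (y - x) := rfl
  have hd1 : edgeDir q 1 = ‖y - x‖⁻¹ • (x - y) := by
    rw [norm_sub_rev]
    rfl
  have hns : ∀ i, q i ≠ q (i + 1) := by
    intro i
    fin_cases i
    · exact hxy
    · exact hxy.symm
  have htraj : IsClosedBilliardTrajectory K q := by
    refine ⟨hns, fun i => ?_, fun i hi => ?_⟩
    · fin_cases i
      · exact hK.segment_subset hx hy
      · exact hK.segment_subset hy hx
    · suffices ∃ n, IsUnitNormalAt K (q (i + 1)) n ∧
          edgeDir q (i + 1) = edgeDir q i - (2 * inner ℝ (edgeDir q i) n) • n from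
        ⟨this.choose_spec.1.mem_frontier, this⟩
      refine exists_isUnitNormalAt_reflect ?_ (norm_edgeDir (hns i)) (norm_edgeDir (hns _)) hi ?_
      · fin_cases i
        · exact hy
        · exact hx
      · intro p hp
        have a1 : ‖y - x‖⁻¹ • (x - y) - ‖y - x‖⁻¹ • (y - x) = (2 * ‖y - x‖⁻¹) • (x - y) := by
          module
        have a2 : ‖y - x‖⁻¹ • (y - x) - ‖y - x‖⁻¹ • (x - y) = (2 * ‖y - x‖⁻¹) • (y - x) := by
          module
        fin_cases i
        · change 0 ≤ inner ℝ (p - y) (edgeDir q 1 - edgeDir q 0)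
          rw [hd0, hd1, a1, inner_smul_right]
          exact mul_nonneg (by positivity) (h2 p hp)
        · change 0 ≤ inner ℝ (p - x) (edgeDir q 0 - edgeDir q 1)
          rw [hd0, hd1, a2, inner_smul_right]
          exact mul_nonneg (by positivity) (h1 p hp)
  refine (iInf_le_of_le 1 <| iInf_le_of_le q <| iInf_le_of_le htraj ?_)
  apply ENNReal.ofReal_le_ofReal
  rw [perimeter, Fin.sum_univ_two]
  change ‖y - x‖ + ‖x - y‖ ≤ _
  rw [norm_sub_rev x y]
  linarith

/-! ### Plane geometry -/

/-- The oriented area of the parallelogram spanned by two vectors of the plane. -/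
def cross (u v : EuclideanSpace ℝ (Fin 2)) : ℝ := u 0 * v 1 - u 1 * v 0

/-- The rotation of the plane by a right angle. -/
def rot (u : EuclideanSpace ℝ (Fin 2)) : EuclideanSpace ℝ (Fin 2) := !₂[-u 1, u 0]

theorem inner_eq_coord (u v : EuclideanSpace ℝ (Fin 2)) :
    inner ℝ u v = u 0 * v 0 + u 1 * v 1 := by
  simp [PiLp.inner_apply, Fin.sum_univ_two, mul_comm]

theorem norm_sq_eq_coord (u : EuclideanSpace ℝ (Fin 2)) : ‖u‖ ^ 2 = u 0 ^ 2 + u 1 ^ 2 := by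
  rw [← real_inner_self_eq_norm_sq, inner_eq_coord]
  ring

@[simp] theorem rot_zero_coord (u : EuclideanSpace ℝ (Fin 2)) : rot u 0 = -u 1 := rfl

@[simp] theorem rot_one_coord (u : EuclideanSpace ℝ (Fin 2)) : rot u 1 = u 0 := rfl

theorem inner_rot (u v : EuclideanSpace ℝ (Fin 2)) : inner ℝ (rot u) v = cross u v := by
  rw [inner_eq_coord, cross, rot_zero_coord, rot_one_coord]
  ring

theorem norm_rot (u : EuclideanSpace ℝ (Fin 2)) : ‖rot u‖ = ‖u‖ := by
  rw [← sq_eq_sq₀ (norm_nonneg _) (norm_nonneg _), norm_sq_eq_coord, norm_sq_eq_coord,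
    rot_zero_coord, rot_one_coord]
  ring

theorem rot_sub (u v : EuclideanSpace ℝ (Fin 2)) : rot (u - v) = rot u - rot v := by
  ext i
  fin_cases i
  · simp [rot]; ring
  · simp [rot]

theorem cross_sq (u v : EuclideanSpace ℝ (Fin 2)) :
    cross u v ^ 2 = ‖u‖ ^ 2 * ‖v‖ ^ 2 - inner ℝ u v ^ 2 := by
  rw [norm_sq_eq_coord, norm_sq_eq_coord, inner_eq_coord, cross]
  ring

/-- A nondegenerate triangle with prescribed edge vectors can be placed with its circumcentre at the
origin; the circumradius is the product of the side lengths over four times the area. -/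
theorem exists_circumcenter {x : Fin 3 → EuclideanSpace ℝ (Fin 2)} (hs : x 0 + x 1 + x 2 = 0)
    (hX : cross (x 0) (x 1) ≠ 0) :
    ∃ y : Fin 3 → EuclideanSpace ℝ (Fin 2), (∀ k, y (k + 2) - y (k + 1) = x k) ∧
      ∀ k, ‖y k‖ = ‖x 0‖ * ‖x 1‖ * ‖x 2‖ / (2 * |cross (x 0) (x 1)|) := by
  obtain ⟨X, hXd⟩ : ∃ X, X = cross (x 0) (x 1) := ⟨_, rfl⟩
  have h2 : x 2 = -x 0 - x 1 := by
    rw [← sub_eq_zero, ← hs]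
    abel
  set p : EuclideanSpace ℝ (Fin 2) :=
    -(2 * X)⁻¹ • (‖x 0‖ ^ 2 • rot (x 1) + ‖x 1‖ ^ 2 • rot (x 0)) with hp
  rw [← hXd] at hX
  have c0 : p 0 = (2 * X)⁻¹ * (‖x 0‖ ^ 2 * x 1 1 + ‖x 1‖ ^ 2 * x 0 1) := by
    simp [hp]; ring
  have c1 : p 1 = -(2 * X)⁻¹ * (‖x 0‖ ^ 2 * x 1 0 + ‖x 1‖ ^ 2 * x 0 0) := by
    simp [hp]; ring
  have hX2 : X = x 0 0 * x 1 1 - x 0 1 * x 1 0 := hXd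
  have hsq : ∀ y : EuclideanSpace ℝ (Fin 2),
      ‖y‖ ^ 2 = ‖x 0‖ ^ 2 * ‖x 1‖ ^ 2 * ‖x 2‖ ^ 2 / (4 * X ^ 2) →
      ‖y‖ = ‖x 0‖ * ‖x 1‖ * ‖x 2‖ / (2 * |cross (x 0) (x 1)|) := by
    intro y hy
    rw [← sq_eq_sq₀ (norm_nonneg _) (by positivity), hy, div_pow, mul_pow, mul_pow, mul_pow,
      sq_abs, ← hXd]
    norm_num
  have n2 : ‖p‖ ^ 2 = ‖x 0‖ ^ 2 * ‖x 1‖ ^ 2 * ‖x 2‖ ^ 2 / (4 * X ^ 2) := by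
    rw [norm_sq_eq_coord p, c0, c1, norm_sq_eq_coord (x 2), h2]
    simp only [PiLp.sub_apply, PiLp.neg_apply]
    rw [norm_sq_eq_coord, norm_sq_eq_coord]
    field_simp
    ring
  have i0 : 2 * inner ℝ p (x 0) = ‖x 0‖ ^ 2 := by
    have : 2 * inner ℝ p (x 0) = X⁻¹ * (‖x 0‖ ^ 2 * X) := by
      rw [inner_eq_coord, c0, c1, mul_inv, hX2]
      ring
    rw [this]
    field_simp
  have i1 : 2 * inner ℝ p (x 1) = -‖x 1‖ ^ 2 := by
    have : 2 * inner ℝ p (x 1) = X⁻¹ * (-‖x 1‖ ^ 2 * X) := by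
      rw [inner_eq_coord, c0, c1, mul_inv, hX2]
      ring
    rw [this]
    field_simp
  refine ⟨![p + x 1, p - x 0, p], fun k => ?_, fun k => hsq _ ?_⟩
  · fin_cases k
    · exact sub_sub_cancel p (x 0)
    · exact add_sub_cancel_left p (x 1)
    · change p - x 0 - (p + x 1) = x 2
      rw [h2]
      abel
  · rw [← n2]
    fin_cases k
    · change ‖p + x 1‖ ^ 2 = _
      rw [norm_add_sq_real, i1]
      ring
    · change ‖p - x 0‖ ^ 2 = _
      rw [norm_sub_sq_real, i0]
      ring
    · rfl

/-! ### Product of the distances to the vertices of a triangle -/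

/-- The case of a right angle in `four_mul_norm_mul_norm_mul_norm_le`. -/
theorem four_mul_norm_mul_norm_mul_norm_le_of_inner_eq_zero {a b c : EuclideanSpace ℝ (Fin 2)}
    {L : ℝ} (hab : inner ℝ a b = 0) (hac : inner ℝ a c ≤ 0) (hbc : inner ℝ b c ≤ 0)
    (hLa : ‖c - a‖ ≤ L) (hLb : ‖c - b‖ ≤ L) :
    4 * (‖a‖ * ‖b‖ * ‖c‖) ≤ L * |cross (b - a) (c - a)| := by
  have hL : 0 ≤ L := (norm_nonneg _).trans hLa
  rcases eq_or_ne a 0 with rfl | ha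
  · simp only [norm_zero, zero_mul, mul_zero]
    positivity
  rcases eq_or_ne b 0 with rfl | hb
  · simp only [norm_zero, zero_mul, mul_zero]
    positivity
  have ha' := norm_pos_iff.2 ha
  have hb' := norm_pos_iff.2 hb
  have hC : |cross a b| = ‖a‖ * ‖b‖ := by
    rw [← sq_eq_sq₀ (abs_nonneg _) (by positivity), sq_abs, cross_sq, hab]
    ring
  have hC0 : cross a b ≠ 0 := by
    rw [← abs_pos, hC]
    positivity
  -- in the orthogonal basis `a`, `b` the vector `c` has nonpositive coordinates `-s`, `-t`
  obtain ⟨s, hs⟩ : ∃ s, s = -cross c b / cross a b := ⟨_, rfl⟩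
  obtain ⟨t, ht⟩ : ∃ t, t = -cross a c / cross a b := ⟨_, rfl⟩
  have hc : c = -s • a - t • b := by
    have hexp : cross a b = a 0 * b 1 - a 1 * b 0 := rfl
    ext i
    fin_cases i
    · simp only [Fin.zero_eta, PiLp.sub_apply, PiLp.smul_apply, smul_eq_mul, hs, ht]
      field_simp
      simp only [cross]
      ring
    · simp only [Fin.mk_one, PiLp.sub_apply, PiLp.smul_apply, smul_eq_mul, hs, ht]
      field_simp
      simp only [cross]
      ring
  have hs0 : 0 ≤ s := by
    rw [hc, inner_sub_right, inner_smul_right, inner_smul_right, hab,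
      real_inner_self_eq_norm_sq] at hac
    have : 0 ≤ s * ‖a‖ ^ 2 := by linarith
    exact nonneg_of_mul_nonneg_left this (by positivity)
  have ht0 : 0 ≤ t := by
    rw [hc, inner_sub_right, inner_smul_right, inner_smul_right, real_inner_comm, hab,
      real_inner_self_eq_norm_sq] at hbc
    have : 0 ≤ t * ‖b‖ ^ 2 := by linarith
    exact nonneg_of_mul_nonneg_left this (by positivity)
  have hcr : |cross (b - a) (c - a)| = (1 + s + t) * (‖a‖ * ‖b‖) := by
    have : cross (b - a) (c - a) = (1 + s + t) * cross a b := by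
      rw [hc]
      simp only [cross, PiLp.sub_apply, PiLp.smul_apply, smul_eq_mul]
      ring
    rw [this, abs_mul, hC, abs_of_nonneg (by positivity)]
  have h1 : (1 + s + t) • c = s • (c - a) + t • (c - b) := by
    have h0 : s • (c - a) + t • (c - b) = (s + t) • c + (-s • a - t • b) := by module
    rw [h0, ← hc]
    module
  have h2 : (1 + s + t) * ‖c‖ ≤ (s + t) * L := by
    have h3 : ‖(1 + s + t) • c‖ ≤ s * ‖c - a‖ + t * ‖c - b‖ := by
      rw [h1]
      refine (norm_add_le _ _).trans (le_of_eq ?_)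
      rw [norm_smul, norm_smul, Real.norm_of_nonneg hs0, Real.norm_of_nonneg ht0]
    rw [norm_smul, Real.norm_of_nonneg (by positivity)] at h3
    nlinarith [mul_le_mul_of_nonneg_left hLa hs0, mul_le_mul_of_nonneg_left hLb ht0]
  have h4 : 4 * ‖c‖ ≤ L * (1 + s + t) := by
    have h5 : 4 * ‖c‖ * (1 + s + t) ≤ L * (1 + s + t) * (1 + s + t) := by
      nlinarith [mul_nonneg hL (sq_nonneg (1 - s - t))]
    exact le_of_mul_le_mul_right h5 (by positivity)
  rw [hcr]
  calc 4 * (‖a‖ * ‖b‖ * ‖c‖) = ‖a‖ * ‖b‖ * (4 * ‖c‖) := by ring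
    _ ≤ ‖a‖ * ‖b‖ * (L * (1 + s + t)) := by gcongr
    _ = _ := by ring

/-- Twice the oriented area of a triangle. -/
def dblArea (v : Fin 3 → EuclideanSpace ℝ (Fin 2)) : ℝ := cross (v 1 - v 0) (v 2 - v 0)

theorem cross_sub_sub (v : Fin 3 → EuclideanSpace ℝ (Fin 2)) (k : Fin 3) :
    cross (v (k + 1) - v k) (v (k + 2) - v k) = dblArea v := by
  fin_cases k
  · rfl
  · change cross (v 2 - v 1) (v 0 - v 1) = _
    simp only [dblArea, cross, PiLp.sub_apply]
    ring
  · change cross (v 0 - v 2) (v 1 - v 2) = _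
    simp only [dblArea, cross, PiLp.sub_apply]
    ring

@[to_additive]
theorem mul_mul_rotate {M : Type*} [CommMonoid M] (f : Fin 3 → M) (k : Fin 3) :
    f k * f (k + 1) * f (k + 2) = f 0 * f 1 * f 2 := by
  fin_cases k
  · rfl
  · change f 1 * f 2 * f 0 = _
    rw [mul_comm, mul_assoc]
  · change f 2 * f 0 * f 1 = _
    rw [mul_assoc, mul_comm]

/-- If all sides of a triangle are seen from `z` under nonacute angles, then the product of the
distances of `z` from the vertices is at most half the area times the longest side. The product is
the modulus of a cubic polynomial in `z`, so by the maximum principle it suffices to consider points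
at which one of the angles is right. -/
theorem four_mul_norm_mul_norm_mul_norm_le {v : Fin 3 → EuclideanSpace ℝ (Fin 2)}
    {z : EuclideanSpace ℝ (Fin 2)} {L : ℝ}
    (hz : ∀ k, inner ℝ (v (k + 1) - z) (v (k + 2) - z) ≤ 0) (hL : ∀ i j, ‖v i - v j‖ ≤ L) :
    4 * (‖v 0 - z‖ * ‖v 1 - z‖ * ‖v 2 - z‖) ≤ L * |dblArea v| := by
  set e : ℂ → EuclideanSpace ℝ (Fin 2) := fun ζ => !₂[ζ.re, ζ.im] with he
  set g : Fin 3 → ℂ → ℝ := fun k ζ => inner ℝ (v (k + 1) - e ζ) (v (k + 2) - e ζ) with hg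
  have hgc : ∀ k, Continuous (g k) := by
    intro k
    simp only [hg, he, inner_eq_coord]
    simp only [PiLp.sub_apply, Matrix.cons_val_zero, Matrix.cons_val_one]
    fun_prop
  set p : Fin 3 → ℂ := fun k => ⟨v k 0, v k 1⟩ with hp
  have hnorm : ∀ k ζ, ‖p k - ζ‖ = ‖v k - e ζ‖ := by
    intro k ζ
    rw [← sq_eq_sq₀ (norm_nonneg _) (norm_nonneg _), norm_sq_eq_coord, ← Complex.normSq_eq_norm_sq,
      Complex.normSq_apply]
    simp [he, hp]
    ring
  set U : Set ℂ := {ζ | ∀ k, g k ζ ≤ 0} with hU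
  have hUc : IsClosed U := by
    rw [hU, Set.ofPred_forall]
    exact isClosed_iInter fun k => isClosed_le (hgc k) continuous_const
  have hUb : Bornology.IsBounded U := by
    refine (Metric.isBounded_closedBall (x := p 1) (r := L)).subset fun ζ hζ => ?_
    rw [mem_closedBall_iff_norm, norm_sub_rev, hnorm]
    have h0 : inner ℝ (v 1 - e ζ) (v 2 - e ζ) ≤ 0 := hζ 0
    have h1 : v 2 - e ζ = (v 1 - e ζ) - (v 1 - v 2) := by abel
    rw [h1, inner_sub_right, real_inner_self_eq_norm_sq] at h0
    have h2 := real_inner_le_norm (v 1 - e ζ) (v 1 - v 2)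
    have h3 := hL 1 2
    by_contra! h4
    nlinarith [norm_nonneg (v 1 - v 2)]
  set f : ℂ → ℂ := fun ζ => 4 * ((p 0 - ζ) * (p 1 - ζ) * (p 2 - ζ)) with hf
  have hfn : ∀ ζ, ‖f ζ‖ = 4 * (‖v 0 - e ζ‖ * ‖v 1 - e ζ‖ * ‖v 2 - e ζ‖) := by
    intro ζ
    simp only [hf, norm_mul, hnorm]
    norm_num
  have hfd : Differentiable ℂ f := by fun_prop
  have hfr : ∀ ζ ∈ frontier U, ‖f ζ‖ ≤ L * |dblArea v| := by
    intro ζ hζ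
    have hζU : ζ ∈ U := hUc.frontier_subset hζ
    obtain ⟨k, hk⟩ : ∃ k, g k ζ = 0 := by
      by_contra! hc
      refine hζ.2 (mem_interior.2 ⟨{ζ | ∀ k, g k ζ < 0}, fun ξ hξ k => (hξ k).le, ?_,
        fun k => lt_of_le_of_ne (hζU k) (hc k)⟩)
      rw [Set.ofPred_forall]
      exact isOpen_iInter_of_finite fun k => isOpen_lt (hgc k) continuous_const
    have h1 : inner ℝ (v (k + 2) - e ζ) (v k - e ζ) ≤ 0 := by
      have := hζU (k + 1)
      simp only [hg] at this
      rwa [add_assoc, add_assoc, show (1 : Fin 3) + 1 = 2 from rfl,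
        show (1 : Fin 3) + 2 = 0 from rfl, add_zero] at this
    have h2 : inner ℝ (v (k + 1) - e ζ) (v k - e ζ) ≤ 0 := by
      have := hζU (k + 2)
      simp only [hg] at this
      rwa [add_assoc, add_assoc, show (2 : Fin 3) + 1 = 0 from rfl,
        show (2 : Fin 3) + 2 = 1 from rfl, add_zero, real_inner_comm] at this
    have h3 := four_mul_norm_mul_norm_mul_norm_le_of_inner_eq_zero hk h2 h1
      (L := L) (by rw [sub_sub_sub_cancel_right]; exact hL _ _)
      (by rw [sub_sub_sub_cancel_right]; exact hL _ _)
    rw [hfn, ← mul_mul_rotate (fun k => ‖v k - e ζ‖) k, mul_assoc ‖v k - e ζ‖, mul_comm ‖v k - e ζ‖]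
    refine h3.trans (le_of_eq ?_)
    rw [sub_sub_sub_cancel_right, sub_sub_sub_cancel_right, ← cross_sub_sub v (k + 1), add_assoc,
      add_assoc, show (1 : Fin 3) + 1 = 2 from rfl, show (1 : Fin 3) + 2 = 0 from rfl, add_zero]
  have hez : e ⟨z 0, z 1⟩ = z := by
    ext i
    fin_cases i <;> rfl
  have := Complex.norm_le_of_forall_mem_frontier_norm_le hUb hfd.diffContOnCl hfr
    (z := ⟨z 0, z 1⟩) (subset_closure fun k => by simp only [hg, hez]; exact hz k)
  rwa [hfn, hez] at this

/-! ### Barycentric coordinates in the plane -/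

theorem fin_three_eq_or_eq_or_eq (j k : Fin 3) : j = k ∨ j = k + 1 ∨ j = k + 2 := by
  revert j k
  decide

/-- The gradient of the barycentric coordinate of the plane belonging to the vertex `v k`. -/
noncomputable def baryGrad (v : Fin 3 → EuclideanSpace ℝ (Fin 2)) (k : Fin 3) :
    EuclideanSpace ℝ (Fin 2) :=
  (dblArea v)⁻¹ • rot (v (k + 2) - v (k + 1))

/-- The barycentric coordinate of the point `y` belonging to the vertex `v k`. -/
noncomputable def bary (v : Fin 3 → EuclideanSpace ℝ (Fin 2)) (k : Fin 3)
    (y : EuclideanSpace ℝ (Fin 2)) : ℝ :=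
  inner ℝ (baryGrad v k) (y - v (k + 1))

theorem inner_baryGrad_sub (v : Fin 3 → EuclideanSpace ℝ (Fin 2)) (k : Fin 3)
    (x y : EuclideanSpace ℝ (Fin 2)) :
    inner ℝ (baryGrad v k) (x - y) = bary v k x - bary v k y := by
  rw [bary, bary, ← inner_sub_right, sub_sub_sub_cancel_right]

theorem bary_eq (v : Fin 3 → EuclideanSpace ℝ (Fin 2)) (k : Fin 3)
    (y : EuclideanSpace ℝ (Fin 2)) :
    bary v k y = (dblArea v)⁻¹ * cross (v (k + 2) - v (k + 1)) (y - v (k + 1)) := by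
  rw [bary, baryGrad, real_inner_smul_left, inner_rot]

theorem sum_bary {v : Fin 3 → EuclideanSpace ℝ (Fin 2)} (hv : dblArea v ≠ 0)
    (y : EuclideanSpace ℝ (Fin 2)) : ∑ k, bary v k y = 1 := by
  simp only [bary_eq, ← Finset.mul_sum]
  rw [inv_mul_eq_one₀ hv, Fin.sum_univ_three]
  change _ = cross (v 2 - v 1) (y - v 1) + cross (v 0 - v 2) (y - v 2) +
    cross (v 1 - v 0) (y - v 0)
  simp only [dblArea, cross, PiLp.sub_apply]
  ring

theorem sum_bary_smul {v : Fin 3 → EuclideanSpace ℝ (Fin 2)} (hv : dblArea v ≠ 0)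
    (y : EuclideanSpace ℝ (Fin 2)) : ∑ k, bary v k y • v k = y := by
  have key : ∑ k, cross (v (k + 2) - v (k + 1)) (y - v (k + 1)) • v k = dblArea v • y := by
    rw [Fin.sum_univ_three]
    change cross (v 2 - v 1) (y - v 1) • v 0 + cross (v 0 - v 2) (y - v 2) • v 1 +
      cross (v 1 - v 0) (y - v 0) • v 2 = _
    ext i
    fin_cases i <;>
    · simp only [dblArea, cross, PiLp.sub_apply, PiLp.add_apply, PiLp.smul_apply, smul_eq_mul,
        Fin.zero_eta, Fin.mk_one]
      ring
  simp only [bary_eq, ← smul_smul, ← Finset.smul_sum]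
  rw [key, inv_smul_smul₀ hv]

theorem bary_self {v : Fin 3 → EuclideanSpace ℝ (Fin 2)} (hv : dblArea v ≠ 0) (k : Fin 3) :
    bary v k (v k) = 1 := by
  have := cross_sub_sub v (k + 1)
  rw [add_assoc, add_assoc, show (1 : Fin 3) + 1 = 2 from rfl, show (1 : Fin 3) + 2 = 0 from rfl,
    add_zero] at this
  rw [bary_eq, this, inv_mul_cancel₀ hv]

theorem bary_of_ne (v : Fin 3 → EuclideanSpace ℝ (Fin 2)) {j k : Fin 3} (h : j ≠ k) :
    bary v k (v j) = 0 := by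
  rw [bary_eq]
  rcases (fin_three_eq_or_eq_or_eq j k).resolve_left h with rfl | rfl
  · simp [cross]
  · simp only [cross]
    ring

theorem convexHull_range_eq_bary_nonneg {v : Fin 3 → EuclideanSpace ℝ (Fin 2)}
    (hv : dblArea v ≠ 0) : convexHull ℝ (Set.range v) = {y | ∀ k, 0 ≤ bary v k y} := by
  apply Set.Subset.antisymm
  · refine convexHull_min ?_ ?_
    · rintro _ ⟨j, rfl⟩ k
      rcases eq_or_ne j k with rfl | h
      · rw [bary_self hv]
        exact zero_le_one
      · rw [bary_of_ne v h]
    · intro x hx y hy a b ha hb hab k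
      have h1 : a • x + b • y - v (k + 1) = a • (x - v (k + 1)) + b • (y - v (k + 1)) := by
        rw [← eq_sub_iff_add_eq] at hab
        rw [hab]
        module
      have h2 : bary v k (a • x + b • y) = a * bary v k x + b * bary v k y := by
        simp only [bary]
        rw [h1, inner_add_right, inner_smul_right, inner_smul_right]
      rw [h2]
      exact add_nonneg (mul_nonneg ha (hx k)) (mul_nonneg hb (hy k))
  · intro y hy
    rw [← sum_bary_smul hv y]
    exact (convex_convexHull ℝ _).sum_mem (fun k _ => hy k) (sum_bary hv y)
      fun k _ => subset_convexHull ℝ _ ⟨k, rfl⟩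

/-! ### Lower bounds for triangles and their polar bodies -/

theorem le_alpha {E : Type*} [NormedAddCommGroup E] [InnerProductSpace ℝ E] {K : Set E} {a : ℝ}
    (h : ∀ (m : ℕ) (q : Fin (m + 1) → E), IsClosedBilliardTrajectory K q → a ≤ perimeter q) :
    ENNReal.ofReal a ≤ alpha K :=
  le_iInf fun m => le_iInf fun q => le_iInf fun hq => ENNReal.ofReal_le_ofReal (h m q hq)

theorem fin_three_add_add (k : Fin 3) : k + 1 + 1 = k + 2 ∧ k + 1 + 2 = k ∧ k + 2 + 1 = k ∧
    k + 2 + 2 = k + 1 := by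
  revert k
  decide

/-- A triangle inside a disc of radius `r` has no closed billiard trajectory shorter than twice its
area over `r`. -/
theorem ofReal_le_alpha_triangle {v : Fin 3 → EuclideanSpace ℝ (Fin 2)} (hv : dblArea v ≠ 0)
    {o : EuclideanSpace ℝ (Fin 2)} {r : ℝ} (hr : 0 < r) (ho : ∀ k, ‖v k - o‖ ≤ r) :
    ENNReal.ofReal (|dblArea v| / r) ≤ alpha (convexHull ℝ (Set.range v)) := by
  refine le_alpha fun m q hq => ?_
  have hset : convexHull ℝ (Set.range v) =
      {y | ∀ k, inner ℝ (-baryGrad v k) y ≤ inner ℝ (-baryGrad v k) (v (k + 1))} := by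
    rw [convexHull_range_eq_bary_nonneg hv]
    ext y
    refine forall_congr' fun k => ?_
    rw [bary, inner_sub_right, inner_neg_left, inner_neg_left]
    constructor <;> intro h <;> linarith
  rw [hset] at hq
  have hX : 0 < |dblArea v| := abs_pos.2 hv
  have key := hq.sum_le_mul_perimeter (lam := fun _ => 1) (fun _ => zero_le_one) (fun k _ => ?_)
    (y := fun k => -(dblArea v)⁻¹ • rot (v k - o)) (fun k => ?_) (ρ := |dblArea v|⁻¹ * r)
    (fun k => ?_)
  · have h1 : ∑ k, 1 * inner ℝ (-baryGrad v k) (v (k + 1)) = 1 := by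
      have : ∀ k : Fin 3, 1 * inner ℝ (-baryGrad v k) (v (k + 1)) = bary v k 0 := by
        intro k
        rw [bary, zero_sub, inner_neg_left, inner_neg_right, one_mul]
      simp only [this]
      exact sum_bary hv 0
    rw [h1] at key
    rw [div_le_iff₀ hr]
    calc |dblArea v| = |dblArea v| * 1 := (mul_one _).symm
      _ ≤ |dblArea v| * (|dblArea v|⁻¹ * r * perimeter q) := by gcongr
      _ = perimeter q * r := by field_simp
  · -- push away from the vertex `v k`
    refine ⟨(v (k + 1) - v k) + (v (k + 2) - v k), fun j hj => ?_⟩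
    rw [inner_neg_left, inner_add_right, inner_baryGrad_sub, inner_baryGrad_sub,
      bary_of_ne v hj.symm]
    have hj' := (fin_three_eq_or_eq_or_eq j k).resolve_left hj
    have hne : k + 1 ≠ k + 2 := (by decide : ∀ k : Fin 3, k + 1 ≠ k + 2) k
    rcases hj' with rfl | rfl
    · rw [bary_self hv, bary_of_ne v hne.symm]
      norm_num
    · rw [bary_self hv, bary_of_ne v hne]
      norm_num
  · rw [one_smul, baryGrad, ← smul_sub, ← rot_sub, sub_sub_sub_cancel_right, neg_smul]
  · rw [norm_smul, norm_neg, norm_inv, Real.norm_eq_abs, norm_rot]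
    gcongr
    exact ho k

theorem polarBody_convexHull_range {E ι : Type*} [NormedAddCommGroup E] [InnerProductSpace ℝ E]
    (v : ι → E) (z : E) :
    polarBody (convexHull ℝ (Set.range v)) z = {y | ∀ k, inner ℝ (v k - z) y ≤ 1} := by
  apply Set.Subset.antisymm
  · exact fun y hy k => hy _ (subset_convexHull ℝ _ ⟨k, rfl⟩)
  · intro y hy
    have : convexHull ℝ (Set.range v) ⊆ {x | inner ℝ (x - z) y ≤ 1} := by
      refine convexHull_min ?_ ?_
      · rintro _ ⟨k, rfl⟩
        exact hy k
      · intro x hx x' hx' a b ha hb hab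
        have h1 : a • x + b • x' - z = a • (x - z) + b • (x' - z) := by
          rw [← eq_sub_iff_add_eq] at hab
          rw [hab]
          module
        change inner ℝ (a • x + b • x' - z) y ≤ 1
        rw [h1, inner_add_left, real_inner_smul_left, real_inner_smul_left]
        have e1 : a * inner ℝ (x - z) y ≤ a * 1 := mul_le_mul_of_nonneg_left hx ha
        have e2 : b * inner ℝ (x' - z) y ≤ b * 1 := mul_le_mul_of_nonneg_left hx' hb
        linarith
    exact this

/-- A triangle whose angle opposite to the edge `x k` is not acute lies in the disc having this edge
as a diameter. -/
theorem exists_norm_le_of_inner_nonneg {E : Type*} [NormedAddCommGroup E] [InnerProductSpace ℝ E]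
    {x : Fin 3 → E} (hs : x 0 + x 1 + x 2 = 0) {k : Fin 3}
    (hk : 0 ≤ inner ℝ (x (k + 1)) (x (k + 2))) :
    ∃ y : Fin 3 → E, (∀ j, y (j + 2) - y (j + 1) = x j) ∧ ∀ j, ‖y j‖ ≤ ‖x k‖ / 2 := by
  have main : ∀ a b c : E, a + b + c = 0 → 0 ≤ inner ℝ b c → ∃ p q r : E,
      r - q = a ∧ p - r = b ∧ q - p = c ∧ ‖p‖ ≤ ‖a‖ / 2 ∧ ‖q‖ ≤ ‖a‖ / 2 ∧ ‖r‖ ≤ ‖a‖ / 2 := by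
    intro a b c habc hbc
    have ha : a = -(b + c) := by rw [← add_eq_zero_iff_eq_neg, ← add_assoc, habc]
    refine ⟨(1 / 2 : ℝ) • (b - c), -(1 / 2 : ℝ) • a, (1 / 2 : ℝ) • a, by module,
      by rw [ha]; module, by rw [ha]; module, ?_, ?_, ?_⟩
    · rw [norm_smul, ha, norm_neg, Real.norm_of_nonneg (by norm_num)]
      have : ‖b - c‖ ≤ ‖b + c‖ := by
        rw [← sq_le_sq₀ (norm_nonneg _) (norm_nonneg _), norm_sub_sq_real, norm_add_sq_real]
        linarith
      linarith
    · rw [norm_smul, norm_neg, Real.norm_of_nonneg (by norm_num)]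
      linarith
    · rw [norm_smul, Real.norm_of_nonneg (by norm_num)]
      linarith
  fin_cases k
  · obtain ⟨p, q, r, h0, h1, h2, n0, n1, n2⟩ := main (x 0) (x 1) (x 2) hs hk
    refine ⟨![p, q, r], fun j => ?_, fun j => ?_⟩
    · fin_cases j <;> assumption
    · fin_cases j <;> assumption
  · obtain ⟨p, q, r, h0, h1, h2, n0, n1, n2⟩ :=
      main (x 1) (x 2) (x 0) (by rw [← hs]; abel) hk
    refine ⟨![r, p, q], fun j => ?_, fun j => ?_⟩
    · fin_cases j <;> assumption
    · fin_cases j <;> assumption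
  · obtain ⟨p, q, r, h0, h1, h2, n0, n1, n2⟩ :=
      main (x 2) (x 0) (x 1) (by rw [← hs]; abel) hk
    refine ⟨![q, r, p], fun j => ?_, fun j => ?_⟩
    · fin_cases j <;> assumption
    · fin_cases j <;> assumption

/-- No polar body of a triangle with sides at most `L` has a closed billiard trajectory shorter than
`8 / L`. The dual certificate is a triangle with edges `x k = lam k • (v k - z)`, where the `lam k`
are the barycentric coordinates of `z`. -/
theorem ofReal_le_alpha_polarBody {v : Fin 3 → EuclideanSpace ℝ (Fin 2)} (hv : dblArea v ≠ 0)
    {L : ℝ} (hL0 : 0 < L) (hL : ∀ i j, ‖v i - v j‖ ≤ L) (z : EuclideanSpace ℝ (Fin 2)) :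
    ENNReal.ofReal (8 / L) ≤ alpha (polarBody (convexHull ℝ (Set.range v)) z) := by
  refine le_alpha fun m q hq => ?_
  rw [polarBody_convexHull_range] at hq
  have hgrad : ∀ j k, inner ℝ (v j - z) (baryGrad v k) = bary v k (v j) - bary v k z := by
    intro j k
    rw [real_inner_comm, inner_baryGrad_sub]
  by_cases hneg : ∃ k, bary v k z < 0
  · -- `z` lies outside the triangle, and the polar body can be pushed into its own interior
    obtain ⟨k, hk⟩ := hneg
    obtain ⟨i, j, -, hj⟩ := hq.exists_touch (-baryGrad v k)
    rw [inner_neg_right, hgrad] at hj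
    rcases eq_or_ne j k with rfl | hjk
    · rw [bary_self hv] at hj
      linarith
    · rw [bary_of_ne v hjk] at hj
      linarith
  push Not at hneg
  obtain ⟨lam, hlam⟩ : ∃ lam : Fin 3 → ℝ, lam = fun k => bary v k z := ⟨_, rfl⟩
  have hlam0 : ∀ k, 0 ≤ lam k := fun k => by rw [hlam]; exact hneg k
  -- only faces with a positive weight need to be touched by the trajectory, so that `z` may also
  -- be a boundary point of the triangle
  have hsum : lam 0 + lam 1 + lam 2 = 1 := by
    have := sum_bary hv z
    rwa [Fin.sum_univ_three, ← congrFun hlam, ← congrFun hlam, ← congrFun hlam] at this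
  obtain ⟨x, hx⟩ : ∃ x : Fin 3 → EuclideanSpace ℝ (Fin 2), x = fun k => lam k • (v k - z) :=
    ⟨_, rfl⟩
  have hxk : ∀ k, x k = lam k • (v k - z) := congrFun hx
  have hxs : x 0 + x 1 + x 2 = 0 := by
    have h1 := sum_bary_smul hv z
    rw [Fin.sum_univ_three, ← congrFun hlam, ← congrFun hlam, ← congrFun hlam] at h1
    have h2 : x 0 + x 1 + x 2 =
        (lam 0 • v 0 + lam 1 • v 1 + lam 2 • v 2) - (lam 0 + lam 1 + lam 2) • z := by
      rw [hxk, hxk, hxk]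
      module
    rw [h2, h1, hsum, one_smul, sub_self]
  have hxn : ∀ k, ‖x k‖ ≤ L / 4 := by
    intro k
    have hs' : lam k + lam (k + 1) + lam (k + 2) = 1 := by rw [add_add_rotate, hsum]
    have hxs' : x k + x (k + 1) + x (k + 2) = 0 := by rw [add_add_rotate, hxs]
    have h1 : v k - z = lam (k + 1) • (v k - v (k + 1)) + lam (k + 2) • (v k - v (k + 2)) := by
      have h2 : lam (k + 1) • (v k - v (k + 1)) + lam (k + 2) • (v k - v (k + 2)) =
          (lam k + lam (k + 1) + lam (k + 2)) • (v k - z) -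
            (lam k • (v k - z) + lam (k + 1) • (v (k + 1) - z) +
              lam (k + 2) • (v (k + 2) - z)) := by
        module
      rw [h2, ← hxk, ← hxk, ← hxk, hxs', hs', one_smul, sub_zero]
    have h3 : ‖v k - z‖ ≤ (lam (k + 1) + lam (k + 2)) * L := by
      rw [h1]
      refine (norm_add_le _ _).trans ?_
      rw [norm_smul, norm_smul, Real.norm_of_nonneg (hlam0 _), Real.norm_of_nonneg (hlam0 _),
        add_mul]
      exact add_le_add (mul_le_mul_of_nonneg_left (hL _ _) (hlam0 _))
        (mul_le_mul_of_nonneg_left (hL _ _) (hlam0 _))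
    rw [hxk, norm_smul, Real.norm_of_nonneg (hlam0 _)]
    have h4 := mul_le_mul_of_nonneg_left h3 (hlam0 k)
    have h5 : lam (k + 1) + lam (k + 2) = 1 - lam k := by linarith
    rw [h5] at h4
    nlinarith [mul_nonneg hL0.le (sq_nonneg (1 - 2 * lam k))]
  obtain ⟨y, hy, hyn⟩ : ∃ y : Fin 3 → EuclideanSpace ℝ (Fin 2),
      (∀ k, y (k + 2) - y (k + 1) = x k) ∧ ∀ k, ‖y k‖ ≤ L / 8 := by
    by_cases hob : ∃ k, 0 ≤ inner ℝ (x (k + 1)) (x (k + 2))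
    · obtain ⟨k, hk⟩ := hob
      obtain ⟨y, hy, hyn⟩ := exists_norm_le_of_inner_nonneg hxs hk
      exact ⟨y, hy, fun j => (hyn j).trans (by linarith [hxn k])⟩
    push Not at hob
    have hin : ∀ k, 0 < lam (k + 1) ∧ inner ℝ (v (k + 1) - z) (v (k + 2) - z) ≤ 0 := by
      intro k
      have h1 := hob k
      rw [hxk, hxk, real_inner_smul_left, inner_smul_right, ← mul_assoc] at h1
      have h2 := mul_nonneg (hlam0 (k + 1)) (hlam0 (k + 2))
      refine ⟨lt_of_le_of_ne (hlam0 _) fun h0 => ?_, ?_⟩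
      · rw [← h0] at h1
        simp at h1
      · by_contra! h3
        exact absurd h1 (not_lt.2 (mul_nonneg h2 h3.le))
    have hp0 : 0 < lam 0 := (hin 2).1
    have hp1 : 0 < lam 1 := (hin 0).1
    have hp2 : 0 < lam 2 := (hin 1).1
    have hcr : cross (x 0) (x 1) = lam 0 * lam 1 * lam 2 * dblArea v := by
      have h1 : lam 2 * dblArea v = cross (v 0 - z) (v 1 - z) := by
        rw [congrFun hlam, bary_eq]
        change (dblArea v)⁻¹ * cross (v 1 - v 0) (z - v 0) * dblArea v = _
        rw [mul_right_comm, inv_mul_cancel₀ hv, one_mul]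
        simp only [cross, PiLp.sub_apply]
        ring
      rw [mul_assoc, h1, hxk, hxk]
      simp only [cross, PiLp.smul_apply, smul_eq_mul]
      ring
    have hcr0 : cross (x 0) (x 1) ≠ 0 := by
      rw [hcr]
      exact mul_ne_zero (by positivity) hv
    obtain ⟨y, hy, hyn⟩ := exists_circumcenter hxs hcr0
    refine ⟨y, hy, fun k => (hyn k).trans_le ?_⟩
    have hX : 0 < |dblArea v| := abs_pos.2 hv
    rw [hcr, abs_mul, abs_of_pos (mul_pos (mul_pos hp0 hp1) hp2), hxk, hxk, hxk, norm_smul,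
      norm_smul, norm_smul, Real.norm_of_nonneg hp0.le, Real.norm_of_nonneg hp1.le,
      Real.norm_of_nonneg hp2.le, div_le_iff₀ (by positivity)]
    have h4 := mul_le_mul_of_nonneg_left
      (four_mul_norm_mul_norm_mul_norm_le (fun k => (hin k).2) hL)
      (mul_pos (mul_pos hp0 hp1) hp2).le
    linarith
  have key := hq.sum_le_mul_perimeter hlam0 (fun k hk => ⟨baryGrad v k, fun j hj => ?_⟩)
    (y := y) (fun k => by rw [hy, hxk]) hyn
  · rw [Fin.sum_univ_three, mul_one, mul_one, mul_one, hsum] at key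
    rw [div_le_iff₀ hL0]
    linarith
  · rw [hgrad, bary_of_ne v hj, ← congrFun hlam k]
    linarith

/-! ### Upper bounds for triangles and their polar bodies -/

theorem convex_polarBody {E : Type*} [NormedAddCommGroup E] [InnerProductSpace ℝ E] (K : Set E)
    (z : E) : Convex ℝ (polarBody K z) := by
  intro p hp p' hp' a b ha hb hab x hx
  rw [inner_add_right, inner_smul_right, inner_smul_right]
  have e1 := mul_le_mul_of_nonneg_left (hp x hx) ha
  have e2 := mul_le_mul_of_nonneg_left (hp' x hx) hb
  linarith

/-- A linear inequality that holds at the vertices of a triangle holds on the triangle. -/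
theorem inner_nonneg_of_mem_convexHull_range {E ι : Type*} [NormedAddCommGroup E]
    [InnerProductSpace ℝ E] {v : ι → E} {x d : E} (h : ∀ j, 0 ≤ inner ℝ (v j - x) d) :
    ∀ y ∈ convexHull ℝ (Set.range v), 0 ≤ inner ℝ (y - x) d := by
  intro y hy
  have : convexHull ℝ (Set.range v) ⊆ {y | inner ℝ x d ≤ inner ℝ y d} := by
    refine convexHull_min ?_ ?_
    · rintro _ ⟨j, rfl⟩
      have := h j
      rw [inner_sub_left] at this
      exact sub_nonneg.1 this
    · intro p hp p' hp' a b ha hb hab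
      change _ ≤ inner ℝ (a • p + b • p') d
      rw [inner_add_left, real_inner_smul_left, real_inner_smul_left]
      have e1 : a * inner ℝ x d ≤ a * inner ℝ p d := mul_le_mul_of_nonneg_left hp ha
      have e2 : b * inner ℝ x d ≤ b * inner ℝ p' d := mul_le_mul_of_nonneg_left hp' hb
      have e3 : inner ℝ x d = a * inner ℝ x d + b * inner ℝ x d := by
        rw [← add_mul, hab, one_mul]
      linarith
  rw [inner_sub_left]
  exact sub_nonneg.2 (this hy)

/-- For a triangle with edge vectors `a`, `b`, `c`, the vectors `‖a‖² b + ‖b‖² a` and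
`‖b‖² c + ‖c‖² b` (of equal length by `norm_bisector`) are reflections of each other in the side
`b`. In an acute triangle they are the directions of two consecutive sides of the orthic
triangle, and the sign in the second claim makes the normal at the bounce an outer one. -/
theorem inner_bisector_sub {E : Type*} [NormedAddCommGroup E] [InnerProductSpace ℝ E]
    {a b c : E} (h : a + b + c = 0) :
    inner ℝ b ((‖b‖ ^ 2 • c + ‖c‖ ^ 2 • b) - (‖a‖ ^ 2 • b + ‖b‖ ^ 2 • a)) = 0 ∧
    inner ℝ a ((‖b‖ ^ 2 • c + ‖c‖ ^ 2 • b) - (‖a‖ ^ 2 • b + ‖b‖ ^ 2 • a)) ≤ 0 := by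
  have hc : c = -a - b := by
    rw [← sub_eq_zero, ← h]
    abel
  have hn : ‖c‖ ^ 2 = ‖a‖ ^ 2 + 2 * inner ℝ a b + ‖b‖ ^ 2 := by
    rw [hc, ← norm_add_sq_real, ← norm_neg]
    congr 2
    abel
  rw [hn, hc]
  simp only [inner_sub_right, inner_add_right, inner_smul_right, inner_neg_right,
    real_inner_self_eq_norm_sq, real_inner_comm a b]
  constructor
  · ring
  · have := real_inner_mul_inner_self_le a b
    rw [real_inner_self_eq_norm_sq, real_inner_self_eq_norm_sq] at this
    nlinarith

theorem norm_bisector {E : Type*} [NormedAddCommGroup E] [InnerProductSpace ℝ E]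
    {a b c : E} (h : a + b + c = 0) :
    ‖‖a‖ ^ 2 • b + ‖b‖ ^ 2 • a‖ = ‖a‖ * ‖b‖ * ‖c‖ := by
  have hc : c = -a - b := by
    rw [← sub_eq_zero, ← h]
    abel
  have hn : ‖c‖ ^ 2 = ‖a‖ ^ 2 + 2 * inner ℝ a b + ‖b‖ ^ 2 := by
    rw [hc, ← norm_add_sq_real, ← norm_neg]
    congr 2
    abel
  rw [← sq_eq_sq₀ (norm_nonneg _) (by positivity), mul_pow, mul_pow, hn, norm_add_sq_real,
    norm_smul, norm_smul, inner_smul_left, inner_smul_right, real_inner_comm]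
  simp only [norm_pow, norm_norm, conj_trivial]
  ring

/-- A triangle with a right or obtuse angle at `v k` lies in the disc having the side opposite to
`v k` as a diameter, and its altitude through `v k` is a double normal. -/
theorem exists_alpha_triangle_le_of_inner_nonpos {v : Fin 3 → EuclideanSpace ℝ (Fin 2)}
    (hv : dblArea v ≠ 0) {k : Fin 3} (hk : inner ℝ (v (k + 1) - v k) (v (k + 2) - v k) ≤ 0) :
    ∃ (o : EuclideanSpace ℝ (Fin 2)) (r : ℝ), 0 < r ∧ (∀ j, ‖v j - o‖ ≤ r) ∧
      alpha (convexHull ℝ (Set.range v)) ≤ ENNReal.ofReal (|dblArea v| / r) := by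
  have hj : ∀ j, j = k ∨ j = k + 1 ∨ j = k + 2 := fun j => fin_three_eq_or_eq_or_eq j k
  obtain ⟨a, ha⟩ : ∃ a, a = v (k + 1) - v k := ⟨_, rfl⟩
  obtain ⟨b, hb⟩ : ∃ b, b = v (k + 2) - v k := ⟨_, rfl⟩
  have hX : cross a b = dblArea v := by rw [ha, hb, cross_sub_sub]
  rw [← ha, ← hb] at hk
  have hab : v (k + 2) - v (k + 1) = b - a := by rw [ha, hb, sub_sub_sub_cancel_right]
  have hne : b - a ≠ 0 := by
    intro h0
    rw [sub_eq_zero] at h0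
    rw [← hX, h0] at hv
    exact hv (by simp only [cross]; ring)
  have hpos : 0 < ‖b - a‖ := norm_pos_iff.2 hne
  refine ⟨v k + (1 / 2 : ℝ) • (a + b), ‖b - a‖ / 2, by positivity, fun j => ?_, ?_⟩
  · rcases hj j with rfl | rfl | rfl
    · rw [sub_add_cancel_left, norm_neg, norm_smul, Real.norm_of_nonneg (by norm_num)]
      have : ‖a + b‖ ≤ ‖b - a‖ := by
        rw [← sq_le_sq₀ (norm_nonneg _) (norm_nonneg _), norm_sub_sq_real, norm_add_sq_real,
          real_inner_comm a b]
        linarith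
      linarith
    · have : v (k + 1) - (v k + (1 / 2 : ℝ) • (a + b)) = -(1 / 2 : ℝ) • (b - a) := by
        rw [← sub_sub, ← ha]
        module
      rw [this, norm_smul, norm_neg, Real.norm_of_nonneg (by norm_num)]
      linarith
    · have : v (k + 2) - (v k + (1 / 2 : ℝ) • (a + b)) = (1 / 2 : ℝ) • (b - a) := by
        rw [← sub_sub, ← hb]
        module
      rw [this, norm_smul, Real.norm_of_nonneg (by norm_num)]
      linarith
  -- `v k + d` is the foot of the altitude
  obtain ⟨t, ht⟩ : ∃ t, t = -inner ℝ a (b - a) / ‖b - a‖ ^ 2 := ⟨_, rfl⟩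
  obtain ⟨d, hd⟩ : ∃ d, d = a + t • (b - a) := ⟨_, rfl⟩
  have hdo : inner ℝ d (b - a) = 0 := by
    rw [hd, inner_add_left, real_inner_smul_left, real_inner_self_eq_norm_sq, ht]
    field_simp
    ring
  have hcr : |dblArea v| = ‖d‖ * ‖b - a‖ := by
    have h1 : cross d (b - a) = dblArea v := by
      rw [← hX, hd]
      simp only [cross, PiLp.add_apply, PiLp.sub_apply, PiLp.smul_apply, smul_eq_mul]
      ring
    rw [← h1, ← sq_eq_sq₀ (abs_nonneg _) (by positivity), sq_abs, cross_sq, hdo]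
    ring
  have hd0 : d ≠ 0 := by
    rintro rfl
    rw [norm_zero, zero_mul, abs_eq_zero] at hcr
    exact hv hcr
  have ht0 : 0 ≤ t := by
    rw [ht, inner_sub_right, real_inner_self_eq_norm_sq]
    have := sq_nonneg ‖a‖
    exact div_nonneg (by linarith) (by positivity)
  have ht1 : t ≤ 1 := by
    rw [ht, div_le_one (by positivity), norm_sub_sq_real, inner_sub_right,
      real_inner_self_eq_norm_sq, real_inner_comm]
    have := sq_nonneg ‖b‖
    rw [real_inner_comm] at hk
    linarith
  have hda : inner ℝ a d = ‖d‖ ^ 2 := by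
    have h1 : a = d - t • (b - a) := by rw [hd, add_sub_cancel_right]
    nth_rw 1 [h1]
    rw [inner_sub_left, real_inner_smul_left, real_inner_comm, real_inner_comm _ (b - a), hdo,
      real_inner_self_eq_norm_sq, mul_zero, sub_zero]
  have hdb : inner ℝ b d = ‖d‖ ^ 2 := by
    have h1 : b = a + (b - a) := by abel
    rw [h1, inner_add_left, hda, real_inner_comm, hdo, add_zero]
  have hmem : ∀ j, v j ∈ convexHull ℝ (Set.range v) := fun j => subset_convexHull ℝ _ ⟨j, rfl⟩
  have hfoot : v k + d ∈ convexHull ℝ (Set.range v) := by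
    have h1 : v k + d = (1 - t) • v (k + 1) + t • v (k + 2) := by
      rw [hd, ← hab, ha]
      module
    rw [h1]
    exact convex_convexHull ℝ _ (hmem _) (hmem _) (by linarith) ht0 (by ring)
  refine (alpha_le_of_double_normal (convex_convexHull ℝ _) (hmem k) hfoot
    (fun h => hd0 (left_eq_add.1 h)) ?_ ?_).trans (ENNReal.ofReal_le_ofReal ?_)
  · apply inner_nonneg_of_mem_convexHull_range
    intro j
    rw [add_sub_cancel_left]
    rcases hj j with rfl | rfl | rfl
    · rw [sub_self, inner_zero_left]
    · rw [← ha, hda]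
      positivity
    · rw [← hb, hdb]
      positivity
  · apply inner_nonneg_of_mem_convexHull_range
    intro j
    rw [sub_add_cancel_left, inner_neg_right, ← sub_sub, inner_sub_left,
      real_inner_self_eq_norm_sq, neg_sub]
    rcases hj j with rfl | rfl | rfl
    · rw [sub_self, inner_zero_left, sub_zero]
      positivity
    · rw [← ha, hda, sub_self]
    · rw [← hb, hdb, sub_self]
  · rw [add_sub_cancel_left, hcr]
    apply le_of_eq
    field_simp

/-- The orthic triangle of an acute triangle is a closed billiard trajectory, whose length is twice
the area of the triangle over its circumradius. -/
theorem exists_alpha_triangle_le_of_inner_pos {v : Fin 3 → EuclideanSpace ℝ (Fin 2)}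
    (hv : dblArea v ≠ 0) (hac : ∀ k, 0 < inner ℝ (v (k + 1) - v k) (v (k + 2) - v k)) :
    ∃ (o : EuclideanSpace ℝ (Fin 2)) (r : ℝ), 0 < r ∧ (∀ j, ‖v j - o‖ ≤ r) ∧
      alpha (convexHull ℝ (Set.range v)) ≤ ENNReal.ofReal (|dblArea v| / r) := by
  obtain ⟨c, hc⟩ : ∃ c : Fin 3 → ℝ, c = fun k => inner ℝ (v (k + 1) - v k) (v (k + 2) - v k) :=
    ⟨_, rfl⟩
  obtain ⟨x, hx⟩ : ∃ x : Fin 3 → EuclideanSpace ℝ (Fin 2), x = fun k => v (k + 2) - v (k + 1) :=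
    ⟨_, rfl⟩
  have hck : ∀ k, c k = inner ℝ (v (k + 1) - v k) (v (k + 2) - v k) := congrFun hc
  have hxk : ∀ k, x k = v (k + 2) - v (k + 1) := congrFun hx
  have hc0 : ∀ k, 0 < c k := fun k => by rw [hck]; exact hac k
  have hx1 : ∀ k, x (k + 1) = v k - v (k + 2) := fun k => by
    rw [hxk, (fin_three_add_add k).1, (fin_three_add_add k).2.1]
  have hx2 : ∀ k, x (k + 2) = v (k + 1) - v k := fun k => by
    rw [hxk, (fin_three_add_add k).2.2.1, (fin_three_add_add k).2.2.2]
  have hxs : ∀ k, x k + x (k + 1) + x (k + 2) = 0 := fun k => by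
    rw [hxk, hx1, hx2]
    abel
  -- `c k` is the inner product of the two sides meeting in `v k`, and `x k` is the opposite side
  have hN : ∀ k, ‖x k‖ ^ 2 = c (k + 1) + c (k + 2) := by
    intro k
    rw [hck, hck, (fin_three_add_add k).1, (fin_three_add_add k).2.1, (fin_three_add_add k).2.2.1,
      (fin_three_add_add k).2.2.2, ← hxk, ← real_inner_self_eq_norm_sq]
    have h1 : v (k + 1) - v (k + 2) = -x k := by rw [hxk, neg_sub]
    rw [h1, inner_neg_right, real_inner_comm (x k) (v k - v (k + 2)), ← sub_eq_add_neg,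
      ← inner_sub_right, sub_sub_sub_cancel_left, ← hxk]
  have hNpos : ∀ k, 0 < ‖x k‖ := by
    intro k
    have : 0 < ‖x k‖ ^ 2 := by rw [hN]; exact add_pos (hc0 _) (hc0 _)
    exact lt_of_le_of_ne (norm_nonneg _) fun h0 => by simp [← h0] at this
  obtain ⟨P, hP⟩ : ∃ P, P = ‖x 0‖ * ‖x 1‖ * ‖x 2‖ := ⟨_, rfl⟩
  have hPpos : 0 < P := by rw [hP]; exact mul_pos (mul_pos (hNpos 0) (hNpos 1)) (hNpos 2)
  have hXsq : dblArea v ^ 2 = c 0 * c 1 + c 1 * c 2 + c 2 * c 0 := by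
    simp only [hck, inner_eq_coord, dblArea, cross]
    change _ = ((v 1 - v 0) 0 * (v 2 - v 0) 0 + (v 1 - v 0) 1 * (v 2 - v 0) 1) *
      ((v 2 - v 1) 0 * (v 0 - v 1) 0 + (v 2 - v 1) 1 * (v 0 - v 1) 1) +
      ((v 2 - v 1) 0 * (v 0 - v 1) 0 + (v 2 - v 1) 1 * (v 0 - v 1) 1) *
      ((v 0 - v 2) 0 * (v 1 - v 2) 0 + (v 0 - v 2) 1 * (v 1 - v 2) 1) +
      ((v 0 - v 2) 0 * (v 1 - v 2) 0 + (v 0 - v 2) 1 * (v 1 - v 2) 1) *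
      ((v 1 - v 0) 0 * (v 2 - v 0) 0 + (v 1 - v 0) 1 * (v 2 - v 0) 1)
    simp only [PiLp.sub_apply]
    ring
  have hcr : cross (x 0) (x 1) = dblArea v := by
    rw [hxk, hxk]
    change cross (v 2 - v 1) (v 0 - v 2) = _
    simp only [dblArea, cross, PiLp.sub_apply]
    ring
  have hXpos : 0 < |dblArea v| := abs_pos.2 hv
  obtain ⟨y, hy, hyn⟩ := exists_circumcenter (hxs 0) (by rw [hcr]; exact hv)
  rw [hcr] at hyn
  simp only [← hP] at hyn
  have hyv : ∀ k, y (k + 2) - v (k + 2) = y (k + 1) - v (k + 1) := by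
    intro k
    rw [sub_eq_sub_iff_sub_eq_sub, hy, hxk]
  have hyv0 : ∀ k, v k - (v 0 - y 0) = y k := by
    intro k
    have h1 : y 1 - v 1 = y 0 - v 0 := (hyv 2).symm ▸ rfl
    have h2 : y 2 - v 2 = y 0 - v 0 := (hyv 1).symm
    fin_cases k
    · exact sub_sub_cancel _ _
    · change v 1 - (v 0 - y 0) = y 1
      rw [← neg_sub (y 0), ← h1]
      abel
    · change v 2 - (v 0 - y 0) = y 2
      rw [← neg_sub (y 0), ← h2]
      abel
  refine ⟨v 0 - y 0, P / (2 * |dblArea v|), by positivity, fun j => ?_, ?_⟩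
  · rw [hyv0, hyn]
  -- the feet of the altitudes
  obtain ⟨q, hq⟩ : ∃ q : Fin (2 + 1) → EuclideanSpace ℝ (Fin 2),
      q = fun k => v (k + 1) + (c (k + 1) / ‖x k‖ ^ 2) • x k := ⟨_, rfl⟩
  have hqk : ∀ k, q k = v (k + 1) + (c (k + 1) / ‖x k‖ ^ 2) • x k := congrFun hq
  obtain ⟨G, hG⟩ : ∃ G : Fin 3 → EuclideanSpace ℝ (Fin 2),
      G = fun k => ‖x k‖ ^ 2 • x (k + 1) + ‖x (k + 1)‖ ^ 2 • x k := ⟨_, rfl⟩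
  have hGk : ∀ k, G k = ‖x k‖ ^ 2 • x (k + 1) + ‖x (k + 1)‖ ^ 2 • x k := congrFun hG
  have hGn : ∀ k, ‖G k‖ = P := by
    intro k
    rw [hGk, norm_bisector (hxs k), hP, mul_mul_rotate (fun k => ‖x k‖)]
  have hmem : ∀ j, v j ∈ convexHull ℝ (Set.range v) := fun j => subset_convexHull ℝ _ ⟨j, rfl⟩
  have hqmem : ∀ k, q k ∈ convexHull ℝ (Set.range v) := by
    intro k
    have h0 := pow_pos (hNpos k) 2
    have h1 : q k = (c (k + 2) / ‖x k‖ ^ 2) • v (k + 1) + (c (k + 1) / ‖x k‖ ^ 2) • v (k + 2) := by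
      have h2 : c (k + 2) / ‖x k‖ ^ 2 = 1 - c (k + 1) / ‖x k‖ ^ 2 := by
        rw [eq_sub_iff_add_eq, ← add_div, add_comm, ← hN, div_self h0.ne']
      rw [hqk, h2, hxk]
      module
    rw [h1]
    refine convex_convexHull ℝ _ (hmem _) (hmem _) (div_nonneg (hc0 _).le h0.le)
      (div_nonneg (hc0 _).le h0.le) ?_
    rw [← add_div, add_comm, ← hN, div_self h0.ne']
  -- the orthic edge from `q k` to `q (k + 1)` is `s k • G k`
  obtain ⟨s, hs⟩ : ∃ s : Fin 3 → ℝ,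
      s = fun k => c (k + 2) / (‖x k‖ ^ 2 * ‖x (k + 1)‖ ^ 2) := ⟨_, rfl⟩
  have hsk : ∀ k, s k = c (k + 2) / (‖x k‖ ^ 2 * ‖x (k + 1)‖ ^ 2) := congrFun hs
  have hs0 : ∀ k, 0 < s k := fun k => by
    rw [hsk]
    exact div_pos (hc0 _) (mul_pos (pow_pos (hNpos _) 2) (pow_pos (hNpos _) 2))
  have hedge : ∀ k, q (k + 1) - q k = s k • G k := by
    intro k
    have n0 := (hNpos k).ne'
    have n1 := (hNpos (k + 1)).ne'
    have h1 : c (k + 1) / ‖x k‖ ^ 2 = 1 - c (k + 2) / ‖x k‖ ^ 2 := by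
      rw [eq_sub_iff_add_eq, ← add_div, ← hN, div_self (pow_ne_zero 2 n0)]
    have h2 : s k * ‖x k‖ ^ 2 = c (k + 2) / ‖x (k + 1)‖ ^ 2 := by
      rw [hsk]
      field_simp
    have h3 : s k * ‖x (k + 1)‖ ^ 2 = c (k + 2) / ‖x k‖ ^ 2 := by
      rw [hsk]
      field_simp
    have h4 : v (k + 2) = v (k + 1) + x k := by rw [hxk]; abel
    rw [hqk, hqk, (fin_three_add_add k).1, h1, hGk, smul_add, smul_smul, smul_smul, h2, h3, h4]
    module
  have hnorm : ∀ k, ‖q (k + 1) - q k‖ = s k * P := by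
    intro k
    rw [hedge, norm_smul, hGn, Real.norm_of_nonneg (hs0 k).le]
  have hdir : ∀ k, edgeDir q k = P⁻¹ • G k := by
    intro k
    rw [edgeDir, hnorm, hedge, smul_smul, mul_inv, mul_right_comm,
      inv_mul_cancel₀ (hs0 k).ne', one_mul]
  have hns : ∀ k, q k ≠ q (k + 1) := by
    intro k h
    have := hnorm k
    rw [h, sub_self, norm_zero] at this
    exact (mul_pos (hs0 k) hPpos).ne this
  have htraj : IsClosedBilliardTrajectory (convexHull ℝ (Set.range v)) q := by
    refine ⟨hns, fun k => (convex_convexHull ℝ _).segment_subset (hqmem _) (hqmem _),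
      fun k hk => ?_⟩
    suffices ∃ n, IsUnitNormalAt (convexHull ℝ (Set.range v)) (q (k + 1)) n ∧
        edgeDir q (k + 1) = edgeDir q k - (2 * inner ℝ (edgeDir q k) n) • n from
      ⟨this.choose_spec.1.mem_frontier, this⟩
    refine exists_isUnitNormalAt_reflect (hqmem _) (norm_edgeDir (hns _)) (norm_edgeDir (hns _))
      hk ?_
    apply inner_nonneg_of_mem_convexHull_range
    intro j
    obtain ⟨hb, ha⟩ := inner_bisector_sub (hxs k)
    have hGG : G (k + 1) - G k = (‖x (k + 1)‖ ^ 2 • x (k + 2) + ‖x (k + 2)‖ ^ 2 • x (k + 1)) -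
        (‖x k‖ ^ 2 • x (k + 1) + ‖x (k + 1)‖ ^ 2 • x k) := by
      rw [hGk, hGk, (fin_three_add_add k).1]
    rw [← hGG] at ha hb
    rw [hdir, hdir, ← smul_sub, inner_smul_right]
    refine mul_nonneg (inv_nonneg.2 hPpos.le) ?_
    rw [hqk, (fin_three_add_add k).1, ← sub_sub, inner_sub_left, real_inner_smul_left, hb, mul_zero,
      sub_zero]
    -- the foot `q (k + 1)` lies on the side from `v (k + 2)` to `v k`, and `v (k + 1)` is opposite
    rcases fin_three_eq_or_eq_or_eq j k with rfl | rfl | rfl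
    · rw [← hx1, hb]
    · rw [← neg_sub, ← hxk, inner_neg_left]
      linarith
    · rw [sub_self, inner_zero_left]
  refine (iInf_le_of_le 2 <| iInf_le_of_le q <| iInf_le_of_le htraj ?_)
  apply ENNReal.ofReal_le_ofReal
  apply le_of_eq
  have hn0 := hNpos 0
  have hn1 := hNpos 1
  have hn2 := hNpos 2
  have N0 : ‖x 0‖ ^ 2 = c 1 + c 2 := hN 0
  have N1 : ‖x 1‖ ^ 2 = c 2 + c 0 := hN 1
  have N2 : ‖x 2‖ ^ 2 = c 0 + c 1 := hN 2
  have S0 : s 0 = c 2 / (‖x 0‖ ^ 2 * ‖x 1‖ ^ 2) := hsk 0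
  have S1 : s 1 = c 0 / (‖x 1‖ ^ 2 * ‖x 2‖ ^ 2) := hsk 1
  have S2 : s 2 = c 1 / (‖x 2‖ ^ 2 * ‖x 0‖ ^ 2) := hsk 2
  have hS : s 0 + s 1 + s 2 = 2 * dblArea v ^ 2 / P ^ 2 := by
    have h1 : s 0 + s 1 + s 2 =
        (c 2 * ‖x 2‖ ^ 2 + c 0 * ‖x 0‖ ^ 2 + c 1 * ‖x 1‖ ^ 2) / P ^ 2 := by
      rw [S0, S1, S2, hP]
      field_simp
    rw [h1, hXsq, N0, N1, N2]
    ring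
  rw [perimeter, Fin.sum_univ_three, hnorm, hnorm, hnorm, ← add_mul, ← add_mul, hS,
    ← sq_abs (dblArea v)]
  field_simp

/-- Every triangle lies in a disc of some radius `r` such that its shortest closed billiard
trajectory is at most twice its area over `r`. -/
theorem exists_alpha_triangle_le {v : Fin 3 → EuclideanSpace ℝ (Fin 2)} (hv : dblArea v ≠ 0) :
    ∃ (o : EuclideanSpace ℝ (Fin 2)) (r : ℝ), 0 < r ∧ (∀ j, ‖v j - o‖ ≤ r) ∧
      alpha (convexHull ℝ (Set.range v)) ≤ ENNReal.ofReal (|dblArea v| / r) := by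
  by_cases h : ∃ k, inner ℝ (v (k + 1) - v k) (v (k + 2) - v k) ≤ 0
  · obtain ⟨k, hk⟩ := h
    exact exists_alpha_triangle_le_of_inner_nonpos hv hk
  · push Not at h
    exact exists_alpha_triangle_le_of_inner_pos hv h

/-- The polar body of a triangle with respect to the midpoint of its longest side, of length `L`,
has a closed billiard trajectory of length `8 / L`, running back and forth across the strip cut out
by the endpoints of this side. -/
theorem alpha_polarBody_midpoint_le {E : Type*} [NormedAddCommGroup E] [InnerProductSpace ℝ E]
    {v : Fin 3 → E} {k : Fin 3}
    (hk : v (k + 1) ≠ v (k + 2)) (hL : ∀ i j, ‖v i - v j‖ ≤ ‖v (k + 1) - v (k + 2)‖) :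
    alpha (polarBody (convexHull ℝ (Set.range v)) (midpoint ℝ (v (k + 1)) (v (k + 2)))) ≤
      ENNReal.ofReal (8 / ‖v (k + 1) - v (k + 2)‖) := by
  have hj : ∀ j, j = k ∨ j = k + 1 ∨ j = k + 2 := fun j => fin_three_eq_or_eq_or_eq j k
  obtain ⟨z, hz⟩ : ∃ z, z = midpoint ℝ (v (k + 1)) (v (k + 2)) := ⟨_, rfl⟩
  obtain ⟨w, hw⟩ : ∃ w, w = v (k + 1) - z := ⟨_, rfl⟩
  have hw2 : v (k + 2) - z = -w := by
    rw [hw, hz, midpoint_eq_smul_add, invOf_eq_inv]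
    module
  have hvv : v (k + 1) - v (k + 2) = (2 : ℝ) • w := by
    rw [← sub_sub_sub_cancel_right _ _ z, hw2, ← hw]
    module
  have hvn : ‖v (k + 1) - v (k + 2)‖ = 2 * ‖w‖ := by
    rw [hvv, norm_smul]
    norm_num
  have hwn : 0 < ‖w‖ := by
    have := norm_pos_iff.2 (sub_ne_zero.2 hk)
    rw [hvn] at this
    linarith
  have hbound : |inner ℝ (v k - z) w| ≤ ‖w‖ ^ 2 := by
    have h1 := hL k (k + 1)
    have h2 := hL k (k + 2)
    rw [hvn, ← sub_sub_sub_cancel_right _ _ z, ← sq_le_sq₀ (norm_nonneg _) (by positivity)] at h1 h2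
    rw [hw2, sub_neg_eq_add, norm_add_sq_real] at h2
    rw [← hw, norm_sub_sq_real] at h1
    -- by polarization, as the other two sides have length at most `2 * ‖w‖`
    have h3 := sq_nonneg ‖v k - z - w‖
    have h4 := sq_nonneg ‖v k - z + w‖
    rw [norm_sub_sq_real] at h3
    rw [norm_add_sq_real] at h4
    rw [abs_le]
    constructor <;> nlinarith
  rw [abs_le] at hbound
  rw [← hz]
  obtain ⟨s, hs⟩ : ∃ s, s = (‖w‖ ^ 2)⁻¹ := ⟨_, rfl⟩
  have hs0 : 0 < s := by rw [hs]; positivity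
  have hsw : s * ‖w‖ ^ 2 = 1 := by rw [hs, inv_mul_cancel₀ (by positivity)]
  have hv1 : v (k + 1) ∈ convexHull ℝ (Set.range v) := subset_convexHull ℝ _ ⟨_, rfl⟩
  have hv2 : v (k + 2) ∈ convexHull ℝ (Set.range v) := subset_convexHull ℝ _ ⟨_, rfl⟩
  have hplus : s • w ∈ polarBody (convexHull ℝ (Set.range v)) z := by
    rw [polarBody_convexHull_range]
    intro j
    rw [inner_smul_right]
    rcases hj j with rfl | rfl | rfl
    · nlinarith
    · rw [← hw, real_inner_self_eq_norm_sq, hsw]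
    · rw [hw2, inner_neg_left, real_inner_self_eq_norm_sq]
      linarith
  have hminus : -s • w ∈ polarBody (convexHull ℝ (Set.range v)) z := by
    rw [polarBody_convexHull_range]
    intro j
    rw [inner_smul_right]
    rcases hj j with rfl | rfl | rfl
    · nlinarith
    · rw [← hw, real_inner_self_eq_norm_sq]
      linarith
    · rw [hw2, inner_neg_left, real_inner_self_eq_norm_sq]
      linarith
  have e1 : -s • w - s • w = -(2 * s) • w := by module
  have e2 : s • w - -s • w = (2 * s) • w := by module
  refine (alpha_le_of_double_normal (convex_polarBody _ _) hplus hminus ?_ ?_ ?_).trans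
    (ENNReal.ofReal_le_ofReal (le_of_eq ?_))
  · intro h
    rw [← sub_eq_zero, e2, smul_eq_zero, ← norm_eq_zero (a := w)] at h
    rcases h with h | h <;> linarith
  · intro p hp
    have h1 := hp _ hv1
    rw [← hw] at h1
    rw [e1, inner_smul_right, inner_sub_left, real_inner_smul_left, real_inner_self_eq_norm_sq, hsw,
      real_inner_comm]
    nlinarith
  · intro p hp
    have h1 := hp _ hv2
    rw [hw2, inner_neg_left] at h1
    rw [e2, inner_smul_right, inner_sub_left, real_inner_smul_left, real_inner_self_eq_norm_sq,
      neg_mul, hsw, real_inner_comm]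
    nlinarith
  · rw [e1, norm_smul, norm_neg, Real.norm_of_nonneg (by positivity), hvn, hs]
    field_simp
    norm_num

/-! ### Steiner symmetrization with respect to an altitude -/

theorem midpoint_eq_of_segment_eq {E : Type*} [AddCommGroup E] [Module ℝ E] {a b a' b' : E}
    (h : segment ℝ a b = segment ℝ a' b') : midpoint ℝ a b = midpoint ℝ a' b' := by
  have ha : a ∈ segment ℝ a' b' := h ▸ left_mem_segment ℝ a b
  have hb : b ∈ segment ℝ a' b' := h ▸ right_mem_segment ℝ a b
  have ha' : a' ∈ segment ℝ a b := h ▸ left_mem_segment ℝ a' b'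
  have hb' : b' ∈ segment ℝ a b := h ▸ right_mem_segment ℝ a' b'
  rw [segment_eq_image'] at ha hb ha' hb'
  obtain ⟨s, ⟨hs0, hs1⟩, hs⟩ := ha
  obtain ⟨t, ⟨ht0, ht1⟩, ht⟩ := hb
  obtain ⟨p, ⟨hp0, hp1⟩, hp⟩ := ha'
  obtain ⟨q, ⟨hq0, hq1⟩, hq⟩ := hb'
  simp only at hs ht hp hq
  have h1 : b - a = (t - s) • (b' - a') := by
    rw [← hs, ← ht]
    module
  have h2 : b' - a' = ((q - p) * (t - s)) • (b' - a') := by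
    rw [← smul_smul, ← h1]
    nth_rw 1 [← hq, ← hp]
    module
  have h3 : (1 - (q - p) * (t - s)) • (b' - a') = 0 := by
    rw [sub_smul, one_smul, ← h2, sub_self]
  have h4 : midpoint ℝ a b = midpoint ℝ a' b' + ((s + t - 1) / 2) • (b' - a') := by
    rw [midpoint_eq_smul_add, midpoint_eq_smul_add, invOf_eq_inv, ← hs, ← ht]
    module
  rw [h4]
  rcases smul_eq_zero.1 h3 with h5 | h5
  · have h6 : s + t = 1 := by
      rcases le_total s t with hst | hst
      · have : (q - p) * (t - s) ≤ 1 * (t - s) :=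
          mul_le_mul_of_nonneg_right (by linarith) (by linarith)
        linarith
      · have : (p - q) * (s - t) ≤ 1 * (s - t) :=
          mul_le_mul_of_nonneg_right (by linarith) (by linarith)
        linarith
    rw [h6]
    simp
  · rw [h5]
    simp

/-- The triangle with vertex `v k` fixed and the opposite side translated along its line such that
the triangle becomes isosceles with apex `v k`. -/
noncomputable def isoscelize (v : Fin 3 → EuclideanSpace ℝ (Fin 2)) (k : Fin 3) :
    Fin 3 → EuclideanSpace ℝ (Fin 2) := fun j =>
  if j = k then v k else
    v j - (inner ℝ (midpoint ℝ (v (k + 1)) (v (k + 2)) - v k) (v (k + 2) - v (k + 1)) /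
      ‖v (k + 2) - v (k + 1)‖ ^ 2) • (v (k + 2) - v (k + 1))

/-- With the altitude `m` and the base `d`, the vertices of a triangle and of the isosceles one
differ only in the component `σ • d` of the median. -/
theorem isoscelize_spec {v : Fin 3 → EuclideanSpace ℝ (Fin 2)} (k : Fin 3)
    (h : v (k + 1) ≠ v (k + 2)) :
    ∃ (σ : ℝ) (m d : EuclideanSpace ℝ (Fin 2)), inner ℝ m d = 0 ∧
      v (k + 1) = v k + (m + σ • d - (1 / 2 : ℝ) • d) ∧
      v (k + 2) = v k + (m + σ • d + (1 / 2 : ℝ) • d) ∧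
      isoscelize v k k = v k ∧
      isoscelize v k (k + 1) = v k + (m - (1 / 2 : ℝ) • d) ∧
      isoscelize v k (k + 2) = v k + (m + (1 / 2 : ℝ) • d) := by
  obtain ⟨d, hd⟩ : ∃ d, d = v (k + 2) - v (k + 1) := ⟨_, rfl⟩
  obtain ⟨n, hn⟩ : ∃ n, n = midpoint ℝ (v (k + 1)) (v (k + 2)) - v k := ⟨_, rfl⟩
  obtain ⟨σ, hσ⟩ : ∃ σ, σ = inner ℝ n d / ‖d‖ ^ 2 := ⟨_, rfl⟩
  have hd0 : 0 < ‖d‖ := by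
    rw [hd]
    exact norm_pos_iff.2 (sub_ne_zero.2 h.symm)
  have h1 : v (k + 1) = v k + (n - (1 / 2 : ℝ) • d) := by
    rw [hn, hd, midpoint_eq_smul_add, invOf_eq_inv]
    module
  have h2 : v (k + 2) = v k + (n + (1 / 2 : ℝ) • d) := by
    rw [hn, hd, midpoint_eq_smul_add, invOf_eq_inv]
    module
  have k1 : k + 1 ≠ k := (by decide : ∀ k : Fin 3, k + 1 ≠ k) k
  have k2 : k + 2 ≠ k := (by decide : ∀ k : Fin 3, k + 2 ≠ k) k
  refine ⟨σ, n - σ • d, d, ?_, ?_, ?_, ?_, ?_, ?_⟩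
  · rw [inner_sub_left, real_inner_smul_left, real_inner_self_eq_norm_sq, hσ]
    field_simp
    ring
  · rw [h1]
    module
  · rw [h2]
    module
  · rw [isoscelize, if_pos rfl]
  · rw [isoscelize, if_neg k1, ← hd, ← hn, ← hσ, h1]
    module
  · rw [isoscelize, if_neg k2, ← hd, ← hn, ← hσ, h2]
    module

theorem dblArea_eq_cross {v : Fin 3 → EuclideanSpace ℝ (Fin 2)} {k : Fin 3}
    {n d : EuclideanSpace ℝ (Fin 2)} (h1 : v (k + 1) = v k + (n - (1 / 2 : ℝ) • d))
    (h2 : v (k + 2) = v k + (n + (1 / 2 : ℝ) • d)) : dblArea v = cross n d := by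
  rw [← cross_sub_sub v k, h1, h2, add_sub_cancel_left, add_sub_cancel_left]
  simp only [cross, PiLp.sub_apply, PiLp.add_apply, PiLp.smul_apply, smul_eq_mul]
  ring

/-- The points of a triangle in terms of the median `n` through the apex `v k` and the base `d`. -/
theorem mem_convexHull_range_iff {v : Fin 3 → EuclideanSpace ℝ (Fin 2)} (hv : dblArea v ≠ 0)
    {k : Fin 3} {n d : EuclideanSpace ℝ (Fin 2)} (h1 : v (k + 1) = v k + (n - (1 / 2 : ℝ) • d))
    (h2 : v (k + 2) = v k + (n + (1 / 2 : ℝ) • d)) (x : EuclideanSpace ℝ (Fin 2)) :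
    x ∈ convexHull ℝ (Set.range v) ↔
      ∃ t s : ℝ, t ≤ 1 ∧ |s| ≤ t / 2 ∧ x = v k + (t • n + s • d) := by
  constructor
  · intro hx
    rw [convexHull_range_eq_bary_nonneg hv] at hx
    have e1 := sum_bary hv x
    have e2 := sum_bary_smul hv x
    rw [Fin.sum_univ_three, ← add_add_rotate (fun j => bary v j x) k] at e1
    rw [Fin.sum_univ_three, ← add_add_rotate (fun j => bary v j x • v j) k] at e2
    have p0 := hx k
    have p1 := hx (k + 1)
    have p2 := hx (k + 2)
    obtain ⟨b, hb⟩ : ∃ b, b = bary v (k + 1) x := ⟨_, rfl⟩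
    obtain ⟨c, hc⟩ : ∃ c, c = bary v (k + 2) x := ⟨_, rfl⟩
    rw [← hb, ← hc] at e1 e2
    rw [← hb] at p1
    rw [← hc] at p2
    have e3 : bary v k x = 1 - b - c := by linarith
    refine ⟨b + c, (c - b) / 2, by linarith, ?_, ?_⟩
    · rw [abs_le]
      constructor <;> linarith
    · rw [← e2, e3, h1, h2]
      module
  · rintro ⟨t, s, ht, hs, rfl⟩
    rw [abs_le] at hs
    have hmem : ∀ j, v j ∈ convexHull ℝ (Set.range v) :=
      fun j => subset_convexHull ℝ _ ⟨j, rfl⟩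
    have h3 : v k + (t • n + s • d) =
        ∑ j : Fin 3, ![1 - t, t / 2 - s, t / 2 + s] j • ![v k, v (k + 1), v (k + 2)] j := by
      rw [Fin.sum_univ_three]
      change _ = (1 - t) • v k + (t / 2 - s) • v (k + 1) + (t / 2 + s) • v (k + 2)
      rw [h1, h2]
      module
    rw [h3]
    refine (convex_convexHull ℝ _).sum_mem (fun j _ => ?_) ?_ fun j _ => ?_
    · fin_cases j
      · change 0 ≤ 1 - t
        linarith
      · change 0 ≤ t / 2 - s
        linarith
      · change 0 ≤ t / 2 + s
        linarith
    · rw [Fin.sum_univ_three]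
      change 1 - t + (t / 2 - s) + (t / 2 + s) = 1
      ring
    · fin_cases j <;> exact hmem _

/-- Steiner symmetrization of a triangle with respect to an altitude makes it isosceles. -/
theorem steinerSymm_triangle {v : Fin 3 → EuclideanSpace ℝ (Fin 2)} (hv : dblArea v ≠ 0)
    (k : Fin 3) (h : v (k + 1) ≠ v (k + 2)) {H : AffineSubspace ℝ (EuclideanSpace ℝ (Fin 2))}
    (hH : ∀ p, p ∈ H ↔ inner ℝ (p - v k) (v (k + 2) - v (k + 1)) = 0)
    (hdir : H.directionᗮ = Submodule.span ℝ {v (k + 2) - v (k + 1)}) :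
    steinerSymm H (convexHull ℝ (Set.range v)) =
      convexHull ℝ (Set.range (isoscelize v k)) := by
  obtain ⟨σ, m, d, hmd, h1, h2, i0, i1, i2⟩ := isoscelize_spec k h
  have hd : v (k + 2) - v (k + 1) = d := by
    rw [h1, h2]
    module
  have hX := dblArea_eq_cross h1 h2
  have hX' := dblArea_eq_cross (i0 ▸ i1) (i0 ▸ i2)
  have hXX : dblArea (isoscelize v k) = dblArea v := by
    rw [hX, hX']
    simp only [cross, PiLp.add_apply, PiLp.smul_apply, smul_eq_mul]
    ring
  have hv' : dblArea (isoscelize v k) ≠ 0 := by rwa [hXX]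
  have hcr : cross m d ≠ 0 := by rwa [← hX']
  have hmem := mem_convexHull_range_iff hv h1 h2
  have hmem' := mem_convexHull_range_iff hv' (i0 ▸ i1) (i0 ▸ i2)
  rw [i0] at hmem'
  rw [hd] at hH hdir
  have hd0 : 0 < ‖d‖ ^ 2 := by
    have : d ≠ 0 := by rw [← hd]; exact sub_ne_zero.2 h.symm
    positivity
  -- the points of the axis
  have haxis : ∀ p, p ∈ H ↔ ∃ t : ℝ, p = v k + t • m := by
    intro p
    rw [hH]
    constructor
    · intro hp
      refine ⟨cross (p - v k) d / cross m d, ?_⟩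
      rw [← sub_eq_iff_eq_add']
      -- both `p - v k` and `m` are orthogonal to `d`, hence parallel
      have key : cross m d • (p - v k) = cross (p - v k) d • m := by
        have e : ∀ u : EuclideanSpace ℝ (Fin 2), inner ℝ u d = 0 →
            ‖d‖ ^ 2 • u = -cross u d • rot d := by
          intro u hu
          have e1 : ‖d‖ ^ 2 • u = -cross u d • rot d + inner ℝ u d • d := by
            ext i
            fin_cases i <;>
            · simp only [norm_sq_eq_coord, inner_eq_coord, cross, PiLp.add_apply, PiLp.smul_apply,
                smul_eq_mul, Fin.zero_eta, Fin.mk_one, rot_zero_coord, rot_one_coord]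
              ring
          rw [e1, hu, zero_smul, add_zero]
        have e2 : ‖d‖ ^ 2 • (cross m d • (p - v k)) = ‖d‖ ^ 2 • (cross (p - v k) d • m) := by
          rw [smul_comm, e _ hp, smul_comm _ _ m, e _ hmd, smul_smul, smul_smul]
          ring_nf
        exact smul_right_injective _ hd0.ne' e2
      rw [div_eq_inv_mul, ← smul_smul, ← key, inv_smul_smul₀ hcr]
    · rintro ⟨t, rfl⟩
      rw [add_sub_cancel_left, real_inner_smul_left, hmd, mul_zero]
  -- the sections orthogonal to the axis
  have hsec : ∀ t x, x ∈ convexHull ℝ (Set.range v) ∩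
      (AffineSubspace.mk' (v k + t • m) H.directionᗮ : Set (EuclideanSpace ℝ (Fin 2))) ↔
      t ≤ 1 ∧ ∃ s : ℝ, |s| ≤ t / 2 ∧ x = v k + (t • (m + σ • d) + s • d) := by
    intro t x
    rw [Set.mem_inter_iff, hmem, SetLike.mem_coe, AffineSubspace.mem_mk', hdir,
      Submodule.mem_span_singleton, vsub_eq_sub]
    constructor
    · rintro ⟨⟨t', s, ht', hs, rfl⟩, c, hc⟩
      have e1 : (t' - t) • m = (c - t' * σ - s) • d := by
        have e0 : (t' - t) • m = v k + (t' • (m + σ • d) + s • d) - (v k + t • m) -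
            (t' * σ + s) • d := by module
        rw [e0, ← hc]
        module
      have e2 : (t' - t) * cross m d = 0 := by
        have : cross ((t' - t) • m) d = 0 := by
          rw [e1]
          simp only [cross, PiLp.smul_apply, smul_eq_mul]
          ring
        rw [← this]
        simp only [cross, PiLp.smul_apply, smul_eq_mul]
        ring
      have e3 : t' = t := by
        rcases mul_eq_zero.1 e2 with e | e
        · linarith
        · exact absurd e hcr
      subst e3
      exact ⟨ht', s, hs, rfl⟩
    · rintro ⟨ht, s, hs, rfl⟩
      exact ⟨⟨t, s, ht, hs, rfl⟩, t * σ + s, by module⟩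
  have hseg : ∀ t : ℝ, 0 ≤ t → t ≤ 1 → convexHull ℝ (Set.range v) ∩
      (AffineSubspace.mk' (v k + t • m) H.directionᗮ : Set (EuclideanSpace ℝ (Fin 2))) =
      segment ℝ (v k + (t • (m + σ • d) + (-(t / 2)) • d))
        (v k + (t • (m + σ • d) + (t / 2) • d)) := by
    intro t ht0 ht1
    ext x
    rw [hsec, segment_eq_image']
    constructor
    · rintro ⟨-, s, hs, rfl⟩
      rw [abs_le] at hs
      rcases ht0.eq_or_lt with rfl | ht
      · have : s = 0 := by linarith
        refine ⟨0, by simp, ?_⟩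
        simp [this]
      · refine ⟨(s + t / 2) / t, ⟨div_nonneg (by linarith) ht0, ?_⟩, ?_⟩
        · rw [div_le_one ht]
          linarith
        · have e1 : v k + (t • (m + σ • d) + (t / 2) • d) -
              (v k + (t • (m + σ • d) + (-(t / 2)) • d)) = t • d := by module
          simp only
          rw [e1, smul_smul, div_mul_cancel₀ _ ht.ne']
          module
    · rintro ⟨θ, ⟨hθ0, hθ1⟩, rfl⟩
      refine ⟨ht1, t * (θ - 1 / 2), ?_, by module⟩
      rw [abs_mul, abs_of_nonneg ht0]
      have : |θ - 1 / 2| ≤ 1 / 2 := by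
        rw [abs_le]
        constructor <;> linarith
      nlinarith
  have hmid : ∀ t : ℝ, midpoint ℝ (v k + (t • (m + σ • d) + (-(t / 2)) • d))
        (v k + (t • (m + σ • d) + (t / 2) • d)) = v k + t • (m + σ • d) := by
    intro t
    rw [midpoint_eq_smul_add, invOf_eq_inv]
    module
  ext x
  rw [hmem']
  constructor
  · rintro ⟨p, hp, a, b, hab, hx⟩
    obtain ⟨t, rfl⟩ := (haxis p).1 hp
    have ha : a ∈ segment ℝ a b := left_mem_segment ℝ a b
    rw [← hab, hsec] at ha
    obtain ⟨ht1, s, hs, -⟩ := ha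
    have ht0 : 0 ≤ t := by linarith [abs_nonneg s]
    have hm : midpoint ℝ a b = v k + t • (m + σ • d) := by
      rw [← hmid, ← midpoint_eq_of_segment_eq (hab.symm.trans (hseg t ht0 ht1))]
    rw [← hab, hsec, hm] at hx
    obtain ⟨-, s', hs', hx⟩ := hx
    refine ⟨t, s', ht1, hs', ?_⟩
    rw [← eq_sub_iff_add_eq] at hx
    rw [hx]
    module
  · rintro ⟨t, s, ht1, hs, rfl⟩
    have ht0 : 0 ≤ t := by linarith [abs_nonneg s]
    refine ⟨v k + t • m, (haxis _).2 ⟨t, rfl⟩, _, _, hseg t ht0 ht1, ?_⟩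
    rw [← hseg t ht0 ht1, hsec, hmid]
    exact ⟨ht1, s, hs, by module⟩

theorem dblArea_isoscelize (v : Fin 3 → EuclideanSpace ℝ (Fin 2)) {k : Fin 3}
    (h : v (k + 1) ≠ v (k + 2)) : dblArea (isoscelize v k) = dblArea v := by
  obtain ⟨σ, m, d, hmd, h1, h2, i0, i1, i2⟩ := isoscelize_spec k h
  rw [dblArea_eq_cross h1 h2, dblArea_eq_cross (i0 ▸ i1) (i0 ▸ i2)]
  simp only [cross, PiLp.add_apply, PiLp.smul_apply, smul_eq_mul]
  ring

/-- Making a triangle isosceles does not increase the radius of the smallest enclosing disc: project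
the centre to the axis. -/
theorem exists_norm_isoscelize_sub_le {v : Fin 3 → EuclideanSpace ℝ (Fin 2)} {k : Fin 3}
    (h : v (k + 1) ≠ v (k + 2)) {o : EuclideanSpace ℝ (Fin 2)} {r : ℝ}
    (ho : ∀ j, ‖v j - o‖ ≤ r) : ∃ o', ∀ j, ‖isoscelize v k j - o'‖ ≤ r := by
  obtain ⟨σ, m, d, hmd, h1, h2, i0, i1, i2⟩ := isoscelize_spec k h
  have hd : d ≠ 0 := by
    rintro rfl
    rw [h1, h2] at h
    simp at h
  have hd0 : 0 < ‖d‖ := norm_pos_iff.2 hd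
  have hr : 0 ≤ r := (norm_nonneg _).trans (ho 0)
  obtain ⟨τ, hτ⟩ : ∃ τ, τ = inner ℝ (o - v k) d / ‖d‖ ^ 2 := ⟨_, rfl⟩
  obtain ⟨e, he⟩ : ∃ e, e = o - v k - τ • d := ⟨_, rfl⟩
  have hed : inner ℝ e d = 0 := by
    rw [he, inner_sub_left, real_inner_smul_left, real_inner_self_eq_norm_sq, hτ]
    field_simp
    ring
  have hsplit : ∀ (u : EuclideanSpace ℝ (Fin 2)) (c : ℝ), inner ℝ u d = 0 →
      ‖u + c • d‖ ^ 2 = ‖u‖ ^ 2 + c ^ 2 * ‖d‖ ^ 2 := by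
    intro u c hu
    rw [norm_add_sq_real, inner_smul_right, hu, norm_smul, mul_pow, Real.norm_eq_abs, sq_abs]
    ring
  have hmed : inner ℝ (m - e) d = 0 := by rw [inner_sub_left, hmd, hed, sub_zero]
  have ho' : o = v k + e + τ • d := by
    rw [he]
    abel
  have b0 := ho k
  have b1 := ho (k + 1)
  have b2 := ho (k + 2)
  have f0 : v k - o = -e + (-τ) • d := by
    rw [ho']
    module
  have f1 : v (k + 1) - o = (m - e) + (σ - τ - 1 / 2) • d := by
    rw [ho', h1]
    module
  have f2 : v (k + 2) - o = (m - e) + (σ - τ + 1 / 2) • d := by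
    rw [ho', h2]
    module
  rw [f0, ← sq_le_sq₀ (norm_nonneg _) hr, hsplit _ _ (by rw [inner_neg_left, hed, neg_zero]),
    norm_neg] at b0
  rw [f1, ← sq_le_sq₀ (norm_nonneg _) hr, hsplit _ _ hmed] at b1
  rw [f2, ← sq_le_sq₀ (norm_nonneg _) hr, hsplit _ _ hmed] at b2
  have hnn := mul_nonneg (sq_nonneg (σ - τ)) (sq_nonneg ‖d‖)
  refine ⟨v k + e, fun j => ?_⟩
  rw [← sq_le_sq₀ (norm_nonneg _) hr]
  rcases fin_three_eq_or_eq_or_eq j k with rfl | rfl | rfl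
  · rw [i0, sub_add_cancel_left, norm_neg]
    nlinarith [mul_nonneg (sq_nonneg τ) (sq_nonneg ‖d‖)]
  · have g : isoscelize v k (k + 1) - (v k + e) = (m - e) + (-(1 / 2) : ℝ) • d := by
      rw [i1]
      module
    rw [g, hsplit _ _ hmed]
    nlinarith
  · have g : isoscelize v k (k + 2) - (v k + e) = (m - e) + (1 / 2 : ℝ) • d := by
      rw [i2]
      module
    rw [g, hsplit _ _ hmed]
    nlinarith

/-- Making a triangle isosceles does not increase its longest side. -/
theorem norm_isoscelize_sub_le {v : Fin 3 → EuclideanSpace ℝ (Fin 2)} {k : Fin 3}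
    (h : v (k + 1) ≠ v (k + 2)) {L : ℝ} (hL : ∀ i j, ‖v i - v j‖ ≤ L) (i j : Fin 3) :
    ‖isoscelize v k i - isoscelize v k j‖ ≤ L := by
  obtain ⟨σ, m, d, hmd, h1, h2, i0, i1, i2⟩ := isoscelize_spec k h
  have hL0 : 0 ≤ L := (norm_nonneg _).trans (hL 0 0)
  have hsplit : ∀ c : ℝ, ‖m + c • d‖ ^ 2 = ‖m‖ ^ 2 + c ^ 2 * ‖d‖ ^ 2 := by
    intro c
    rw [norm_add_sq_real, inner_smul_right, hmd, norm_smul, mul_pow, Real.norm_eq_abs, sq_abs]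
    ring
  have b1 := hL (k + 1) k
  have b2 := hL (k + 2) k
  have b3 := hL (k + 2) (k + 1)
  have f1 : v (k + 1) - v k = m + (σ - 1 / 2) • d := by
    rw [h1]
    module
  have f2 : v (k + 2) - v k = m + (σ + 1 / 2) • d := by
    rw [h2]
    module
  have f3 : v (k + 2) - v (k + 1) = d := by
    rw [h1, h2]
    module
  rw [f3] at b3
  rw [f1, ← sq_le_sq₀ (norm_nonneg _) hL0, hsplit] at b1
  rw [f2, ← sq_le_sq₀ (norm_nonneg _) hL0, hsplit] at b2
  have hnn := mul_nonneg (sq_nonneg σ) (sq_nonneg ‖d‖)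
  have l1 : ‖isoscelize v k (k + 1) - isoscelize v k k‖ ≤ L := by
    have g : isoscelize v k (k + 1) - isoscelize v k k = m + (-(1 / 2) : ℝ) • d := by
      rw [i1, i0]
      module
    rw [← sq_le_sq₀ (norm_nonneg _) hL0, g, hsplit]
    nlinarith
  have l2 : ‖isoscelize v k (k + 2) - isoscelize v k k‖ ≤ L := by
    have g : isoscelize v k (k + 2) - isoscelize v k k = m + (1 / 2 : ℝ) • d := by
      rw [i2, i0]
      module
    rw [← sq_le_sq₀ (norm_nonneg _) hL0, g, hsplit]
    nlinarith
  have l3 : ‖isoscelize v k (k + 2) - isoscelize v k (k + 1)‖ ≤ L := by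
    have g : isoscelize v k (k + 2) - isoscelize v k (k + 1) = d := by
      rw [i2, i1]
      module
    rwa [g]
  rcases fin_three_eq_or_eq_or_eq i k with hi | hi | hi <;>
    rcases fin_three_eq_or_eq_or_eq j k with hj | hj | hj <;>
    rw [hi, hj]
  all_goals first
    | assumption
    | rwa [norm_sub_rev]
    | rwa [sub_self, norm_zero]

/-! ### Conclusion -/

theorem dblArea_ne_zero_of_affineIndependent {v : Fin 3 → EuclideanSpace ℝ (Fin 2)}
    (hv : AffineIndependent ℝ v) : dblArea v ≠ 0 := by
  intro h0
  rw [affineIndependent_iff] at hv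
  have key : ∀ a b : ℝ, a • (v 1 - v 0) + b • (v 2 - v 0) = 0 → a = 0 ∧ b = 0 := by
    intro a b hab
    have := hv Finset.univ ![-a - b, a, b]
      (by
        rw [Fin.sum_univ_three]
        change -a - b + a + b = 0
        ring)
      (by
        rw [Fin.sum_univ_three, ← hab]
        change (-a - b) • v 0 + a • v 1 + b • v 2 = _
        module)
    exact ⟨this 1 (Finset.mem_univ _), this 2 (Finset.mem_univ _)⟩
  have hX : (v 1 - v 0) 0 * (v 2 - v 0) 1 - (v 1 - v 0) 1 * (v 2 - v 0) 0 = 0 := h0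
  have k0 := key ((v 2 - v 0) 0) (-(v 1 - v 0) 0) (by
    ext i
    fin_cases i
    · simp only [Fin.zero_eta, PiLp.add_apply, PiLp.smul_apply, smul_eq_mul, PiLp.zero_apply]
      ring
    · simp only [Fin.mk_one, PiLp.add_apply, PiLp.smul_apply, smul_eq_mul, PiLp.zero_apply]
      linarith)
  have k1 := key ((v 2 - v 0) 1) (-(v 1 - v 0) 1) (by
    ext i
    fin_cases i
    · simp only [Fin.zero_eta, PiLp.add_apply, PiLp.smul_apply, smul_eq_mul, PiLp.zero_apply]
      linarith
    · simp only [Fin.mk_one, PiLp.add_apply, PiLp.smul_apply, smul_eq_mul, PiLp.zero_apply]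
      ring)
  have hz : v 1 - v 0 = 0 := by
    ext i
    fin_cases i
    · exact neg_eq_zero.1 k0.2
    · exact neg_eq_zero.1 k1.2
  exact one_ne_zero (key 1 0 (by rw [hz]; simp)).1

theorem direction_altitude_triangle (T : Affine.Triangle ℝ (EuclideanSpace ℝ (Fin 2)))
    (i : Fin 3) : (T.altitude i).direction =
      (Submodule.span ℝ {T.points (i + 2) - T.points (i + 1)})ᗮ := by
  have htop : vectorSpan ℝ (Set.range T.points) = ⊤ :=
    T.independent.vectorSpan_eq_top_of_card_eq_finrank_add_one (by simp)
  have hc : ({i}ᶜ : Set (Fin 3)) = {i + 2, i + 1} := by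
    ext j
    simp only [Set.mem_compl_iff, Set.mem_singleton_iff, Set.mem_insert_iff]
    revert i j
    decide
  rw [Affine.Simplex.direction_altitude, htop, inf_top_eq, hc, Set.image_pair, vectorSpan_pair,
    vsub_eq_sub]


end Billiard

open Billiard

theorem mainTheorem4
    (T : Affine.Triangle ℝ (EuclideanSpace ℝ (Fin 2))) (i : Fin 3) :
    Billiard.beta (convexHull ℝ (Set.range T.points)) ≤
      Billiard.beta
        (Billiard.steinerSymm (T.altitude i) (convexHull ℝ (Set.range T.points))) := by
  have hv := dblArea_ne_zero_of_affineIndependent T.independent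
  have hne : ∀ k : Fin 3, T.points (k + 1) ≠ T.points (k + 2) := fun k h =>
    (by decide : ∀ k : Fin 3, k + 1 ≠ k + 2) k (T.independent.injective h)
  have hdir := direction_altitude_triangle T i
  rw [steinerSymm_triangle hv i (hne i) (fun p => ?_)
    (by rw [hdir, Submodule.orthogonal_orthogonal])]
  · obtain ⟨o, r, hr, ho, hα⟩ := exists_alpha_triangle_le hv
    obtain ⟨o', ho'⟩ := exists_norm_isoscelize_sub_le (hne i) ho
    obtain ⟨k, hk⟩ := Finite.exists_max fun k : Fin 3 => ‖T.points (k + 1) - T.points (k + 2)‖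
    have hL : ∀ a b, ‖T.points a - T.points b‖ ≤ ‖T.points (k + 1) - T.points (k + 2)‖ := by
      intro a b
      rcases fin_three_eq_or_eq_or_eq a b with rfl | rfl | rfl
      · rw [sub_self, norm_zero]
        exact norm_nonneg _
      · have := hk (b + 2)
        rwa [(fin_three_add_add b).2.2.1, (fin_three_add_add b).2.2.2, norm_sub_rev] at this
      · have := hk (b + 1)
        rwa [(fin_three_add_add b).1, (fin_three_add_add b).2.1] at this
    have hL0 := norm_pos_iff.2 (sub_ne_zero.2 (hne k))
    have hX := dblArea_isoscelize T.points (hne i)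
    have hv' : dblArea (isoscelize T.points i) ≠ 0 := by rwa [hX]
    refine (iInf_le _ (midpoint ℝ (T.points (k + 1)) (T.points (k + 2)))).trans
      (le_iInf fun z => mul_le_mul' (hα.trans ?_)
        ((alpha_polarBody_midpoint_le (hne k) hL).trans ?_))
    · rw [← hX]
      exact ofReal_le_alpha_triangle hv' hr ho'
    · exact ofReal_le_alpha_polarBody hv' hL0 (norm_isoscelize_sub_le (hne i) hL) z
  · rw [← AffineSubspace.vsub_right_mem_direction_iff_mem (T.mem_altitude i), hdir,
      Submodule.mem_orthogonal_singleton_iff_inner_left, vsub_eq_sub]
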